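/- Let $d\ge 1$ and let $\omega=(\omega_1,\dots,\omega_d)\in\mathbb{R}^d$ be such that $1,\omega_1,\dots,\omega_d$ form a $\mathbb{Q}$-basis of a number field $\Phi\subset\mathbb{R}$. Let $\mathbb{Z}_\Phi^\times$ be the group of units of the ring of integers of $\Phi$ and let $r$ be its rank (so $r\ge 1$). Let $R\subset\mathbb{R}^d$ be a bounded convex set with non-empty interior. For $t>1$ put $M(t)=\mathbb{Z}^d\cap tR$, let $y_1(t)<y_2(t)<\dots<y_{|M(t)|}(t)$ be the elements of the set $\{\{m\cdot\omega\}: m\in M(t)\}$ of fractional parts in increasing order (they are pairwise distinct for distinct $m$), and let $\delta_i(t)=y_{i+1}(t)-y_i(t)$ for $1\le i\le |M(t)|-1$. Then there are a finite set $S=\{s_1<\dots<s_J\}\subset\Phi$ and units $u(t)\in\mathbb{Z}_\Phi^\times$ $(t>1)$ with the following two properties. (1) For every $t>1$ and every $1\le i\le |M(t)|-1$, the rescaled gap $u(t)\delta_i(t)$ lies in $S$. (2) For $1\le j\le J$ and $|M(t)|\ge 2$, let $p_j(t)$ be the proportion of the indices $1\le i\le|M(t)|-1$ with $u(t)\delta_i(t)=s_j$.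 Then there are an integer $0\le k\le d+1$, a Lipschitz continuous function $$g:\mathbb{T}^k\times[0,1]^r\to P:=\Big\{(p_1,\dots,p_J): \sum_{j} p_j=1,\ p_j\ge 0\Big\},\qquad \mathbb{T}=\mathbb{R}/\mathbb{Z},$$ vectors $\theta=(\theta_1,\dots,\theta_k)\in\mathbb{R}^k$ and $\beta=(\beta_1,\dots,\beta_r)\in\mathbb{R}^r$, and numbers $0<\alpha<1$ and $C$, such that for all $t>1$ with $|M(t)|\ge 2$ and all $1\le j\le J$, $$\Big| p_j(t)-g_j\big(\theta\log t \bmod \mathbb{Z}^k,\ (\{\beta_1\log t\},\dots,\{\beta_r\log t\})\big)\Big|\le C\,\alpha^{\log t},$$ where $\{x\}$ denotes the fractional part of $x$. -/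

import Mathlib

open scoped Pointwise

/-- The set `M(t) = R(t) ∩ ℤ^d` of integer points in the dilation of `R` by the factor `t`
about the origin. -/
def latticePoints {d : ℕ} (R : Set (Fin d → ℝ)) (t : ℝ) : Set (Fin d → ℤ) :=
  {m | (fun i => (m i : ℝ)) ∈ t • R}

theorem latticePoints_finite {d : ℕ} {R : Set (Fin d → ℝ)} (hR : Bornology.IsBounded R)
    (t : ℝ) : (latticePoints R t).Finite := by
  obtain ⟨C, hC⟩ := (hR.smul₀ t).exists_norm_le
  refine (Set.finite_Icc (fun _ : Fin d => -⌈C⌉) (fun _ => ⌈C⌉)).subset ?_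
  intro m hm
  have h1 : ‖(fun i => (m i : ℝ))‖ ≤ C := hC _ hm
  have h2 : ∀ i, |(m i : ℝ)| ≤ (⌈C⌉ : ℝ) := fun i =>
    ((norm_le_pi_norm (fun i => (m i : ℝ)) i).trans h1).trans (Int.le_ceil C)
  refine ⟨fun i => ?_, fun i => ?_⟩
  · have := (abs_le.mp (h2 i)).1
    exact_mod_cast this
  · have := (abs_le.mp (h2 i)).2
    exact_mod_cast this

/-- The finite set `Y(t) = { {m · ω} : m ∈ M(t) }` of fractional parts. When `1, ω₁, …, ω_d`
are linearly independent over `ℚ`, distinct `m` give distinct fractional parts, so that `Y(t)`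
has exactly `|M(t)|` elements. -/
noncomputable def fracPoints {d : ℕ} (ω : Fin d → ℝ) {R : Set (Fin d → ℝ)}
    (hR : Bornology.IsBounded R) (t : ℝ) : Finset ℝ :=
  (latticePoints_finite hR t).toFinset.image (fun m => Int.fract (∑ i, (m i : ℝ) * ω i))

/-- The elements of `Y(t)` in increasing order (numbered from `0`). -/
noncomputable def orderedPoint {d : ℕ} (ω : Fin d → ℝ) {R : Set (Fin d → ℝ)}
    (hR : Bornology.IsBounded R) (t : ℝ) (i : Fin (fracPoints ω hR t).card) : ℝ :=
  (fracPoints ω hR t).orderEmbOfFin rfl i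

/-- The spacings `δ_i(t) = y_{i+1}(t) - y_i(t)` between consecutive elements of `Y(t)`; there is
one fewer of them than there are points. -/
noncomputable def spacing {d : ℕ} (ω : Fin d → ℝ) {R : Set (Fin d → ℝ)}
    (hR : Bornology.IsBounded R) (t : ℝ) (i : Fin ((fracPoints ω hR t).card - 1)) : ℝ :=
  orderedPoint ω hR t ⟨i + 1, by omega⟩ - orderedPoint ω hR t ⟨i, by omega⟩

/-- The proportion of indices `i` for which the rescaled spacing `c * δ_i(t)` equals `x`. -/
noncomputable def spacingProportion {d : ℕ} (ω : Fin d → ℝ) {R : Set (Fin d → ℝ)}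
    (hR : Bornology.IsBounded R) (t c x : ℝ) : ℝ :=
  ((Finset.univ.filter (fun i => c * spacing ω hR t i = x)).card : ℝ) /
    (((fracPoints ω hR t).card - 1 : ℕ) : ℝ)

/-- The fractional part of a real number, as a point of `[0,1]`. -/
noncomputable def fracUnit (x : ℝ) : unitInterval :=
  ⟨Int.fract x, Int.fract_nonneg x, (Int.fract_lt_one x).le⟩

/-! Let L be the lattice spanned over ℤ by 1, ω₁, …, ω_d. A gap is a positive element of L whose
ω-coordinates are the displacement between two integer points of tR, so all its embeddings are O(t).
The gap itself is O(t^(-d)): from every point of tR, some positive element of L of that size leads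
back into tR (`UnitFlow.exists_successor`). Dirichlet's unit theorem supplies units u(t) that
preserve L, have size about t^d at the given real embedding and about 1/t at all others (`UnitFlow`,
`nonempty_unitFlow`). Then every embedding of u(t)δ is bounded. Since u(t)δ stays in L, it takes
finitely many values (`UnitFlow.exists_bounded_coefficients`).

For the proportions, list the labels in increasing order and let w_j be the displacement of
u(t)⁻¹s_j. If m is not the point with the largest fractional part, its successor is m + w_j for the
first j such that this point lies in tR. So p_j counts the integer points of `returnCell (t • R) w
j`, up to one point (`card_spacing_eq_bounds`). Boundaries of convex sets are thin, so this count is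
t^d times the volume of `returnCell R (t⁻¹ • w) j` up to O(t^(d-1)), uniformly in w
(`card_returnCell_approx`), and the volume is Lipschitz in t⁻¹w (`volume_returnCell_lipschitz`).

It remains to describe t⁻¹w. Coordinates are linear in the embeddings. The given real embedding
contributes O(1/t), and at any other σ the number t⁻¹σ(u(t))⁻¹ is a character in log t times an
exponential in the fractional parts {β_b log t}, because u(t) is a product of fixed units to the
powers ⌊β_b log t⌋ (`inv_prod_zpow_floor_eq`). So t⁻¹w is a Lipschitz function of the quasiperiodic
parameters up to O(1/t) (`UnitFlow.repr_inv_mul_approx`), and 1/t = (e⁻¹)^(log t). -/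

section ReturnCells

open MeasureTheory

/-! ### Boundary layers of convex sets -/

/-- The points within distance `r` of which membership in `Q` changes. -/
def boundaryLayer {d : ℕ} (Q : Set (Fin d → ℝ)) (r : ℝ) : Set (Fin d → ℝ) :=
  {x | ∃ z, ‖z - x‖ ≤ r ∧ ¬(z ∈ Q ↔ x ∈ Q)}

/-- With y = r y', the point is the image under the homothety of the convex combination of x and p +
y' with weights c/(c+r) and r/(c+r). -/
theorem Convex.add_smul_mem_homothety {E : Type*} [NormedAddCommGroup E] [NormedSpace ℝ E]
    {R : Set E} (hR : Convex ℝ R) {p : E} {ρ : ℝ} (hp : Metric.closedBall p ρ ⊆ R)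
    {c r : ℝ} (hc : 0 ≤ c) (hr : 0 ≤ r) {x y : E} (hx : x ∈ R) (hy : ‖y‖ ≤ r * ρ)
    (hcr : 0 < c + r) (hρ : 0 < ρ) :
    p + c • (x - p) + y ∈ AffineMap.homothety p (c + r) '' R := by
  obtain ⟨y', hy', rfl⟩ : ∃ y', ‖y'‖ ≤ ρ ∧ y = r • y' := by
    rcases hr.eq_or_lt with h | h
    · subst h
      refine ⟨0, by simpa using hρ.le, ?_⟩
      have : ‖y‖ ≤ 0 := by simpa using hy
      simpa using this
    · refine ⟨r⁻¹ • y, ?_, by rw [smul_smul, mul_inv_cancel₀ h.ne', one_smul]⟩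
      rw [norm_smul, norm_inv, Real.norm_of_nonneg hr, inv_mul_le_iff₀ h]
      exact hy
  refine ⟨(c / (c + r)) • x + (r / (c + r)) • (p + y'), ?_, ?_⟩
  · apply hR hx (hp _) (by positivity) (by positivity) (by field_simp)
    simpa [mem_closedBall_iff_norm] using hy'
  · rw [AffineMap.homothety_apply]
    simp only [vsub_eq_sub, vadd_eq_add]
    have h1 : c = (c + r) * (c / (c + r)) := by field_simp
    have h2 : r = (c + r) * (r / (c + r)) := by field_simp
    have h3 : c / (c + r) = 1 - r / (c + r) := by field_simp; ring
    rw [h3]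
    rw [smul_sub, smul_add, smul_smul, smul_smul]
    rw [← h2, mul_sub, ← h2]
    module

/-- Moving by at most lρ costs at most l in the dilation factor about p: from R it leads into the
(1+l)-dilate, and from the (1-l)-dilate it leads into R. -/
theorem boundaryLayer_subset {d : ℕ} {R : Set (Fin d → ℝ)} (hR : Convex ℝ R) {p : Fin d → ℝ}
    {ρ : ℝ} (hρ : 0 < ρ) (hp : Metric.closedBall p ρ ⊆ R) {l : ℝ} (hl : 0 ≤ l) (hl1 : l < 1) :
    boundaryLayer R (l * ρ) ⊆
      (AffineMap.homothety p (1 + l) '' R) \ (AffineMap.homothety p (1 - l) '' R) := by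
  rintro x ⟨z, hz, hzx⟩
  have key : ∀ a b : Fin d → ℝ, a ∈ R → ‖b - a‖ ≤ l * ρ →
      b ∈ AffineMap.homothety p (1 + l) '' R := by
    intro a b ha hb
    have := hR.add_smul_mem_homothety hp zero_le_one hl ha hb (by linarith) hρ
    simpa using this
  have key2 : ∀ a b : Fin d → ℝ, a ∈ AffineMap.homothety p (1 - l) '' R → ‖b - a‖ ≤ l * ρ →
      b ∈ R := by
    rintro _ b ⟨a, ha, rfl⟩ hb
    have := hR.add_smul_mem_homothety (c := 1 - l) hp (by linarith) hl ha hb (by linarith) hρ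
    rw [AffineMap.homothety_apply] at this
    simp only [sub_add_cancel, AffineMap.homothety_one, vsub_eq_sub, vadd_eq_add] at this
    have h : p + (1 - l) • (a - p) + (b - ((1 - l) • (a - p) + p)) = b := by abel
    rw [h] at this
    simpa using this
  have hl' : 0 ≤ l * ρ := by positivity
  constructor
  · by_cases hx : x ∈ R
    · exact key x x hx (by simpa using hl')
    · exact key z x (by tauto) (by rwa [norm_sub_rev])
  · intro hx
    have h1 := key2 x x hx (by simpa using hl')
    have h2 := key2 x z hx hz
    tauto

theorem one_add_pow_le_linear {l : ℝ} (hl : 0 ≤ l) (hl1 : l ≤ 1) (d : ℕ) :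
    (1 + l) ^ d ≤ 1 + (2 ^ d - 1) * l := by
  induction d with
  | zero => simp
  | succ n ih =>
    have h2 : (1 : ℝ) ≤ 2 ^ n := one_le_pow₀ (by norm_num)
    rw [pow_succ, pow_succ]
    nlinarith [mul_le_mul_of_nonneg_right ih (by linarith : 0 ≤ 1 + l),
      mul_nonneg (mul_nonneg (sub_nonneg.2 h2) hl) (sub_nonneg.2 hl1)]

/-- The shell between the two dilates has relative volume (1+l)^d - (1-l)^d with l = r/ρ. The chord
bound for the first power and Bernoulli's inequality for the second make this at most (2^d - 1 + d)
l. -/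
theorem volume_boundaryLayer_le {d : ℕ} {R : Set (Fin d → ℝ)} (hR : Convex ℝ R)
    (hb : Bornology.IsBounded R) {p : Fin d → ℝ} {ρ : ℝ} (hρ : 0 < ρ)
    (hp : Metric.closedBall p ρ ⊆ R) :
    ∃ C : ℝ, 0 ≤ C ∧ ∀ r, 0 ≤ r → r < ρ →
      volume (boundaryLayer R r) ≤ ENNReal.ofReal (C * r) := by
  have hV : volume R ≠ ⊤ := hb.measure_lt_top.ne
  have hpR : p ∈ R := hp (by simp [hρ.le])
  refine ⟨(2 ^ d - 1 + d) * volume.real R / ρ, ?_, ?_⟩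
  · have : (1 : ℝ) ≤ 2 ^ d := one_le_pow₀ (by norm_num)
    have : (0 : ℝ) ≤ 2 ^ d - 1 + d := add_nonneg (by linarith) (Nat.cast_nonneg d)
    positivity
  · intro r hr hrρ
    set l := r / ρ with hl
    have hl0 : 0 ≤ l := by positivity
    have hl1 : l < 1 := (div_lt_one hρ).2 hrρ
    have hrl : r = l * ρ := by rw [hl]; field_simp
    have hsub : AffineMap.homothety p (1 - l) '' R ⊆ AffineMap.homothety p (1 + l) '' R := by
      rintro _ ⟨a, ha, rfl⟩
      refine ⟨AffineMap.homothety p ((1 - l) / (1 + l)) a, ?_, ?_⟩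
      · rw [AffineMap.homothety_eq_lineMap]
        apply hR.lineMap_mem hpR ha
        constructor
        · apply div_nonneg <;> linarith
        · rw [div_le_one (by linarith)]; linarith
      · rw [← AffineMap.comp_apply, ← AffineMap.homothety_mul]
        congr 2
        field_simp
    have hconv : Convex ℝ (AffineMap.homothety p (1 - l) '' R) := hR.affine_image _
    rw [hrl]
    refine (measure_mono (boundaryLayer_subset hR hρ hp hl0 hl1)).trans ?_
    rw [measure_sdiff hsub (hconv.nullMeasurableSet volume)
      ((Measure.addHaar_image_homothety volume p (1 - l) R) ▸
        ENNReal.mul_ne_top ENNReal.ofReal_ne_top hV),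
      Measure.addHaar_image_homothety, Measure.addHaar_image_homothety]
    simp only [Module.finrank_fintype_fun_eq_card, Fintype.card_fin]
    rw [← ofReal_measureReal hV, ← ENNReal.ofReal_mul (abs_nonneg _),
      ← ENNReal.ofReal_mul (abs_nonneg _), ← ENNReal.ofReal_sub _ (by positivity)]
    apply ENNReal.ofReal_le_ofReal
    rw [abs_of_nonneg (by positivity), abs_of_nonneg (pow_nonneg (by linarith) _)]
    have h1 := one_add_pow_le_linear hl0 hl1.le d
    have h2 : 1 - d * l ≤ (1 - l) ^ d := by
      have := one_add_mul_le_pow (a := -l) (by linarith) d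
      simpa [sub_eq_add_neg] using this
    have h3 : (0 : ℝ) ≤ volume.real R := measureReal_nonneg
    have : (2 ^ d - 1 + d) * volume.real R / ρ * (l * ρ) =
      ((2 ^ d - 1 + d) * l) * volume.real R := by field_simp
    rw [this, ← sub_mul]
    apply mul_le_mul_of_nonneg_right _ h3
    linarith

/-! ### Cells of first return -/

/-- For a set `Q` and displacements `w₀, …, w_N`, the part of `Q` where the first displacement that
stays in `Q` is `w_j`. The last cell collects everything which is not in an earlier cell. -/
def returnCell {d N : ℕ} (Q : Set (Fin d → ℝ)) (w : Fin (N + 1) → Fin d → ℝ) (j : Fin (N + 1)) :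
    Set (Fin d → ℝ) :=
  {x | x ∈ Q ∧ (j ≠ Fin.last N → x + w j ∈ Q) ∧ ∀ i < j, x + w i ∉ Q}

theorem returnCell_subset {d N : ℕ} (Q : Set (Fin d → ℝ)) (w : Fin (N + 1) → Fin d → ℝ)
    (j : Fin (N + 1)) : returnCell Q w j ⊆ Q := fun _ hx => hx.1

theorem eq_of_mem_returnCell {d N : ℕ} {Q : Set (Fin d → ℝ)} {w : Fin (N + 1) → Fin d → ℝ}
    {i j : Fin (N + 1)} {x : Fin d → ℝ} (hi : x ∈ returnCell Q w i) (hj : x ∈ returnCell Q w j) :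
    i = j := by
  rcases lt_trichotomy i j with h | h | h
  · exact absurd (hi.2.1 (h.trans_le (Fin.le_last j)).ne) (hj.2.2 i h)
  · exact h
  · exact absurd (hj.2.1 (h.trans_le (Fin.le_last i)).ne) (hi.2.2 j h)

theorem exists_mem_returnCell {d N : ℕ} {Q : Set (Fin d → ℝ)} (w : Fin (N + 1) → Fin d → ℝ)
    {x : Fin d → ℝ} (hx : x ∈ Q) : ∃ j, x ∈ returnCell Q w j := by
  classical
  by_cases h : ∃ j, x + w j ∈ Q
  · have hne : (Finset.univ.filter fun j => x + w j ∈ Q).Nonempty := by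
      obtain ⟨j, hj⟩ := h
      exact ⟨j, by simpa using hj⟩
    refine ⟨_, hx, fun _ => (Finset.mem_filter.1 (Finset.min'_mem _ hne)).2, fun i hi hi' => ?_⟩
    exact absurd (Finset.min'_le _ i (by simpa using hi')) (not_le.2 hi)
  · push Not at h
    exact ⟨Fin.last N, hx, fun h' => absurd rfl h', fun i _ => h i⟩

theorem mem_returnCell_congr {d N : ℕ} {Q Q' : Set (Fin d → ℝ)} {w w' : Fin (N + 1) → Fin d → ℝ}
    {x x' : Fin d → ℝ} (h : x ∈ Q ↔ x' ∈ Q') (hw : ∀ i, x + w i ∈ Q ↔ x' + w' i ∈ Q')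
    (j : Fin (N + 1)) : x ∈ returnCell Q w j ↔ x' ∈ returnCell Q' w' j := by
  simp only [returnCell, Set.mem_ofPred_eq, h, hw]

theorem returnCell_smul {d N : ℕ} (R : Set (Fin d → ℝ)) (w : Fin (N + 1) → Fin d → ℝ)
    (j : Fin (N + 1)) {t : ℝ} (ht : 0 < t) :
    returnCell (t • R) w j = t • returnCell R (t⁻¹ • w) j := by
  ext x
  rw [Set.mem_smul_set_iff_inv_smul_mem₀ ht.ne']
  apply mem_returnCell_congr
  · rw [Set.mem_smul_set_iff_inv_smul_mem₀ ht.ne']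
  · intro i
    rw [Set.mem_smul_set_iff_inv_smul_mem₀ ht.ne', smul_add, Pi.smul_apply]

/-- A convex set need not be Borel, but its frontier is null; null measurability is all that the
additivity of volume over cells requires. -/
theorem Convex.nullMeasurableSet_returnCell {d N : ℕ} {R : Set (Fin d → ℝ)} (hR : Convex ℝ R)
    (w : Fin (N + 1) → Fin d → ℝ) (j : Fin (N + 1)) :
    NullMeasurableSet (returnCell R w j) volume := by
  have h : ∀ v : Fin d → ℝ, NullMeasurableSet {x | x + v ∈ R} volume := fun v =>
    (hR.nullMeasurableSet volume).preimage
      (measurePreserving_add_right volume v).quasiMeasurePreserving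
  have h2 : NullMeasurableSet {x : Fin d → ℝ | j ≠ Fin.last N → x + w j ∈ R} volume := by
    by_cases hj : j = Fin.last N
    · simp [hj]
    · simpa [hj] using h (w j)
  have h3 : NullMeasurableSet {x : Fin d → ℝ | ∀ i < j, x + w i ∉ R} volume := by
    have : {x : Fin d → ℝ | ∀ i < j, x + w i ∉ R} = ⋂ i, ⋂ (_ : i < j), {x | x + w i ∈ R}ᶜ := by
      ext; simp
    rw [this]
    exact NullMeasurableSet.iInter fun i => NullMeasurableSet.iInter fun _ => (h _).compl
  exact (hR.nullMeasurableSet volume).inter (h2.inter h3)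

/-- The catch-all role of the last cell makes the cells partition R for arbitrary w. This is what
puts the relative volumes in the simplex at every parameter, not only at those coming from actual
gaps. -/
theorem sum_volume_returnCell {d N : ℕ} {R : Set (Fin d → ℝ)} (hR : Convex ℝ R)
    (hb : Bornology.IsBounded R) (w : Fin (N + 1) → Fin d → ℝ) :
    ∑ j, volume.real (returnCell R w j) = volume.real R := by
  have hU : R = ⋃ j ∈ Finset.univ, returnCell R w j := by
    ext x
    simp only [Finset.mem_univ, Set.iUnion_true, Set.mem_iUnion]
    exact ⟨fun hx => exists_mem_returnCell w hx, fun ⟨j, hj⟩ => hj.1⟩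
  conv_rhs => rw [hU]
  refine (measureReal_biUnion_finset₀ ?_ ?_ ?_).symm
  · intro i _ j _ hij
    exact (Set.disjoint_left.2 fun x hi hj => hij (eq_of_mem_returnCell hi hj)).aedisjoint
  · exact fun j _ => hR.nullMeasurableSet_returnCell w j
  · exact fun j _ => (hb.subset (returnCell_subset _ _ _)).measure_lt_top.ne

/-! ### Volume comparison and counting of lattice points -/

/-- Only subadditivity is used, so neither set has to be measurable. -/
theorem abs_measureReal_sub_le {α : Type*} [MeasurableSpace α] {μ : Measure α} {A B : Set α}
    (hA : μ A ≠ ⊤) (hB : μ B ≠ ⊤) {c : ℝ} (hc : 0 ≤ c)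
    (h : μ {x | ¬(x ∈ A ↔ x ∈ B)} ≤ ENNReal.ofReal c) : |μ.real A - μ.real B| ≤ c := by
  have key : ∀ A B : Set α, μ A ≠ ⊤ → μ B ≠ ⊤ → μ {x | ¬(x ∈ A ↔ x ∈ B)} ≤ ENNReal.ofReal c →
      μ.real A ≤ μ.real B + c := by
    intro A B hA hB h
    have h1 : μ A ≤ μ B + ENNReal.ofReal c := by
      refine (measure_mono (t := B ∪ {x | ¬(x ∈ A ↔ x ∈ B)}) fun x hx => ?_).trans
        ((measure_union_le _ _).trans (by gcongr))
      by_cases hxB : x ∈ B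
      · exact Or.inl hxB
      · exact Or.inr (by simp [hx, hxB])
    rw [← ofReal_measureReal hA, ← ofReal_measureReal hB,
      ← ENNReal.ofReal_add measureReal_nonneg hc] at h1
    exact (ENNReal.ofReal_le_ofReal_iff (add_nonneg measureReal_nonneg hc)).1 h1
  have h1 := key A B hA hB h
  have h2 := key B A hB hA (by simpa only [iff_comm] using h)
  rw [abs_le]
  constructor <;> linarith

theorem volume_floor_preimage {d : ℕ} {E : Set (Fin d → ℝ)} {F : Finset (Fin d → ℤ)}
    (hF : ∀ n : Fin d → ℤ, n ∈ F ↔ (fun i => (n i : ℝ)) ∈ E) :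
    volume {x : Fin d → ℝ | (fun i => (⌊x i⌋ : ℝ)) ∈ E} = F.card := by
  have hU : {x : Fin d → ℝ | (fun i => (⌊x i⌋ : ℝ)) ∈ E} =
      ⋃ n ∈ F, Set.pi Set.univ (fun i => Set.Ico (n i : ℝ) (n i + 1)) := by
    ext x
    simp only [Set.mem_ofPred_eq, Set.mem_iUnion, Set.mem_pi, Set.mem_univ, true_imp_iff,
      exists_prop]
    constructor
    · intro hx
      exact ⟨fun i => ⌊x i⌋, (hF _).2 hx, fun i => ⟨Int.floor_le _, Int.lt_floor_add_one _⟩⟩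
    · rintro ⟨n, hn, hx⟩
      have : ∀ i, ⌊x i⌋ = n i := fun i => Int.floor_eq_iff.2 (hx i)
      simpa [this] using (hF n).1 hn
  rw [hU, measure_biUnion_finset]
  · simp [Real.volume_pi_Ico]
  · intro m _ n _ hmn
    refine Set.disjoint_left.2 fun x hm hn => hmn (funext fun i => ?_)
    rw [← Int.floor_eq_iff.2 (hm i trivial), ← Int.floor_eq_iff.2 (hn i trivial)]
  · exact fun n _ => MeasurableSet.univ_pi fun i => measurableSet_Ico

theorem norm_floor_sub_le {d : ℕ} (x : Fin d → ℝ) : ‖(fun i => (⌊x i⌋ : ℝ)) - x‖ ≤ 1 := by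
  rw [pi_norm_le_iff_of_nonneg zero_le_one]
  intro i
  rw [Pi.sub_apply, Real.norm_eq_abs, abs_le]
  constructor <;> linarith [Int.floor_le (x i), Int.lt_floor_add_one (x i)]

theorem volume_setOf_add_mem {d : ℕ} (A : Set (Fin d → ℝ)) (v : Fin d → ℝ) :
    volume {x | x + v ∈ A} = volume A :=
  measure_preimage_add_right volume v A

theorem boundaryLayer_smul {d : ℕ} (R : Set (Fin d → ℝ)) {t : ℝ} (ht : 0 < t) :
    boundaryLayer (t • R) 1 = t • boundaryLayer R t⁻¹ := by
  ext x
  rw [Set.mem_smul_set_iff_inv_smul_mem₀ ht.ne']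
  constructor
  · rintro ⟨z, hz, h⟩
    refine ⟨t⁻¹ • z, ?_, by simpa only [Set.mem_smul_set_iff_inv_smul_mem₀ ht.ne'] using h⟩
    rw [← smul_sub, norm_smul, Real.norm_of_nonneg (by positivity)]
    exact mul_le_of_le_one_right (by positivity) hz
  · rintro ⟨z, hz, h⟩
    refine ⟨t • z, ?_, by
      simpa only [Set.mem_smul_set_iff_inv_smul_mem₀ ht.ne', inv_smul_smul₀ ht.ne'] using h⟩
    have : t • z - x = t • (z - t⁻¹ • x) := by rw [smul_sub, smul_inv_smul₀ ht.ne']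
    rw [this, norm_smul, Real.norm_of_nonneg ht.le]
    calc t * ‖z - t⁻¹ • x‖ ≤ t * t⁻¹ := by gcongr
      _ = 1 := mul_inv_cancel₀ ht.ne'

/-- A point changes cell only if some x + v i lies in the boundary layer of width ‖v - v'‖, and
there are N + 1 such layers. When ‖v - v'‖ ≥ ρ, the trivial bound by the volume of R suffices. -/
theorem volume_returnCell_lipschitz {d : ℕ} (N : ℕ) {R : Set (Fin d → ℝ)} (hR : Convex ℝ R)
    (hb : Bornology.IsBounded R) (hint : (interior R).Nonempty) :
    ∃ K : ℝ, 0 ≤ K ∧ ∀ (v v' : Fin (N + 1) → Fin d → ℝ) (j : Fin (N + 1)),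
      |volume.real (returnCell R v j) - volume.real (returnCell R v' j)| ≤ K * ‖v - v'‖ := by
  obtain ⟨p, hp⟩ := hint
  obtain ⟨ρ, hρ, hpR⟩ := Metric.nhds_basis_closedBall.mem_iff.1 (mem_interior_iff_mem_nhds.1 hp)
  obtain ⟨C, hC, hl⟩ := volume_boundaryLayer_le hR hb hρ hpR
  have hfin : ∀ (v : Fin (N + 1) → Fin d → ℝ) j, volume (returnCell R v j) ≠ ⊤ := fun v j =>
    (hb.subset (returnCell_subset _ _ _)).measure_lt_top.ne
  have hV : ∀ (v : Fin (N + 1) → Fin d → ℝ) j,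
      volume.real (returnCell R v j) ≤ volume.real R := fun v j =>
    measureReal_mono (returnCell_subset _ _ _) hb.measure_lt_top.ne
  refine ⟨(N + 1) * C + volume.real R / ρ, by positivity, fun v v' j => ?_⟩
  rcases lt_or_ge ‖v - v'‖ ρ with h | h
  · have h0 := norm_nonneg (v - v')
    refine (abs_measureReal_sub_le (hfin v j) (hfin v' j)
      (c := (N + 1) * (C * ‖v - v'‖)) (by positivity) ?_).trans ?_
    · have hsub : {x | ¬(x ∈ returnCell R v j ↔ x ∈ returnCell R v' j)} ⊆
          ⋃ i ∈ Finset.univ, {x | x + v i ∈ boundaryLayer R ‖v - v'‖} := by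
        intro x hx
        by_contra hcon
        apply hx
        refine mem_returnCell_congr Iff.rfl (fun i => ?_) j
        by_contra h'
        apply hcon
        simp only [Finset.mem_univ, Set.iUnion_true, Set.mem_iUnion, Set.mem_ofPred_eq]
        refine ⟨i, x + v' i, ?_, by tauto⟩
        rw [add_sub_add_left_eq_sub, norm_sub_rev]
        exact norm_le_pi_norm (v - v') i
      refine (measure_mono hsub).trans ((measure_biUnion_finset_le _ _).trans ?_)
      simp only [volume_setOf_add_mem]
      rw [Finset.sum_const, nsmul_eq_mul, Finset.card_univ, Fintype.card_fin,
        ENNReal.ofReal_mul (by positivity)]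
      gcongr
      · rw [← Nat.cast_succ, ENNReal.ofReal_natCast]
      · exact hl _ h0 h
    · have : 0 ≤ volume.real R / ρ * ‖v - v'‖ := by positivity
      nlinarith
  · have h1 : volume.real R ≤ volume.real R / ρ * ‖v - v'‖ := by
      rw [div_mul_eq_mul_div, le_div_iff₀ hρ]
      gcongr
    have h2 : 0 ≤ (N + 1) * C * ‖v - v'‖ := by positivity
    have := hV v j
    have := hV v' j
    have h3 : 0 ≤ volume.real (returnCell R v j) := measureReal_nonneg
    have h4 : 0 ≤ volume.real (returnCell R v' j) := measureReal_nonneg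
    rw [abs_le, add_mul]
    constructor <;> linarith

/-- The count is the volume of the points whose coordinatewise floor lies in the cell. Taking floors
moves x and every x + w i by at most 1, so the discrepancy lies in N + 2 translates of the unit
boundary layer of tR. The constants do not depend on w, which will vary with t. -/
theorem card_returnCell_approx {d : ℕ} (N : ℕ) {R : Set (Fin d → ℝ)} (hR : Convex ℝ R)
    (hb : Bornology.IsBounded R) (hint : (interior R).Nonempty) :
    ∃ C T : ℝ, 0 ≤ C ∧ 0 < T ∧ ∀ (t : ℝ) (w : Fin (N + 1) → Fin d → ℝ) (j : Fin (N + 1))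
      (F : Finset (Fin d → ℤ)), T < t →
      (∀ n : Fin d → ℤ, n ∈ F ↔ (fun i => (n i : ℝ)) ∈ returnCell (t • R) w j) →
      |(F.card : ℝ) - t ^ d * volume.real (returnCell R (t⁻¹ • w) j)| ≤ C * (t ^ d / t) := by
  obtain ⟨p, hp⟩ := hint
  obtain ⟨ρ, hρ, hpR⟩ := Metric.nhds_basis_closedBall.mem_iff.1 (mem_interior_iff_mem_nhds.1 hp)
  obtain ⟨C, hC, hl⟩ := volume_boundaryLayer_le hR hb hρ hpR
  refine ⟨(N + 2) * C, ρ⁻¹, by positivity, by positivity, fun t w j F hT hF => ?_⟩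
  have ht : 0 < t := (inv_pos.2 hρ).trans hT
  have htd : t ^ d * volume.real (returnCell R (t⁻¹ • w) j) =
      volume.real (returnCell (t • R) w j) := by
    rw [returnCell_smul R w j ht, measureReal_def, measureReal_def, Measure.addHaar_smul,
      ENNReal.toReal_mul, Module.finrank_fintype_fun_eq_card, Fintype.card_fin,
      ENNReal.toReal_ofReal (abs_nonneg _), abs_of_nonneg (by positivity)]
  have hcard : (F.card : ℝ) =
      volume.real {x : Fin d → ℝ | (fun i => (⌊x i⌋ : ℝ)) ∈ returnCell (t • R) w j} := by
    rw [measureReal_def, volume_floor_preimage hF, ENNReal.toReal_natCast]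
  have hlayer : volume (boundaryLayer (t • R) 1) ≤ ENNReal.ofReal (C * (t ^ d / t)) := by
    rw [boundaryLayer_smul R ht, Measure.addHaar_smul, Module.finrank_fintype_fun_eq_card,
      Fintype.card_fin, abs_of_nonneg (by positivity)]
    calc _ ≤ ENNReal.ofReal (t ^ d) * ENNReal.ofReal (C * t⁻¹) := by
          gcongr
          exact hl _ (by positivity) (inv_lt_of_inv_lt₀ hρ hT)
      _ = _ := by
          rw [← ENNReal.ofReal_mul (by positivity)]
          congr 1
          field_simp
  rw [htd, hcard]
  refine (abs_measureReal_sub_le ?_ ?_ (c := (N + 2) * (C * (t ^ d / t))) (by positivity) ?_).trans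
    (by rw [mul_assoc])
  · rw [volume_floor_preimage hF]
    exact ENNReal.natCast_ne_top _
  · exact ((hb.smul₀ t).subset (returnCell_subset _ _ _)).measure_lt_top.ne
  · have hsub : {x | ¬(x ∈ {x : Fin d → ℝ | (fun i => (⌊x i⌋ : ℝ)) ∈ returnCell (t • R) w j} ↔
        x ∈ returnCell (t • R) w j)} ⊆ boundaryLayer (t • R) 1 ∪
          ⋃ i ∈ Finset.univ, {x | x + w i ∈ boundaryLayer (t • R) 1} := by
      intro x hx
      by_contra hcon
      apply hx
      simp only [Finset.mem_univ, Set.iUnion_true, Set.mem_union, Set.mem_iUnion,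
        Set.mem_ofPred_eq, not_or, not_exists] at hcon
      refine mem_returnCell_congr ?_ (fun i => ?_) j
      · by_contra h'
        exact hcon.1 ⟨_, norm_floor_sub_le x, h'⟩
      · by_contra h'
        refine hcon.2 i ⟨(fun i => (⌊x i⌋ : ℝ)) + w i, ?_, h'⟩
        rw [add_sub_add_right_eq_sub]
        exact norm_floor_sub_le x
    refine (measure_mono hsub).trans ((measure_union_le _ _).trans
      ((add_le_add hlayer (measure_biUnion_finset_le _ _)).trans ?_))
    simp only [volume_setOf_add_mem]
    rw [Finset.sum_const, nsmul_eq_mul, Finset.card_univ, Fintype.card_fin]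
    calc _ ≤ ENNReal.ofReal (C * (t ^ d / t)) +
          ((N + 1 : ℕ) : ENNReal) * ENNReal.ofReal (C * (t ^ d / t)) := by gcongr
      _ = ENNReal.ofReal ((N + 2) * (C * (t ^ d / t))) := by
          rw [← ENNReal.ofReal_natCast, ← ENNReal.ofReal_mul (by positivity),
            ← ENNReal.ofReal_add (by positivity) (by positivity)]
          congr 1
          push_cast
          ring

theorem volume_real_pos_of_interior {d : ℕ} {R : Set (Fin d → ℝ)}
    (hb : Bornology.IsBounded R) (hint : (interior R).Nonempty) : 0 < volume.real R :=
  ENNReal.toReal_pos (Measure.measure_pos_of_nonempty_interior _ hint).ne' hb.measure_lt_top.ne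

/-- The frequency of first returns through `w_j`, with at most one point of each cell discarded,
is given up to `O(1/t)` by relative volume. -/
theorem returnCell_frequency_approx {d : ℕ} (hd : 1 ≤ d) (N : ℕ)
    {R : Set (Fin d → ℝ)} (hR : Convex ℝ R)
    (hb : Bornology.IsBounded R) (hint : (interior R).Nonempty) :
    ∃ C : ℝ, 0 ≤ C ∧ ∀ (t : ℝ) (w : Fin (N + 1) → Fin d → ℝ) (j : Fin (N + 1))
      (M F : Finset (Fin d → ℤ)) (c : ℕ), 1 < t →
      (∀ n : Fin d → ℤ, n ∈ M ↔ (fun i => (n i : ℝ)) ∈ t • R) →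
      (∀ n : Fin d → ℤ, n ∈ F ↔ (fun i => (n i : ℝ)) ∈ returnCell (t • R) w j) →
      c ≤ F.card → F.card ≤ c + 1 → c ≤ M.card - 1 →
      |(c : ℝ) / ((M.card - 1 : ℕ) : ℝ) -
        volume.real (returnCell R (t⁻¹ • w) j) / volume.real R| ≤ C / t := by
  obtain ⟨C₁, T₁, hC₁, hT₁, h₁⟩ := card_returnCell_approx N hR hb hint
  -- With N = 0 the only cell is the whole set, so this instance counts all lattice points of tR.
  obtain ⟨C₂, T₂, hC₂, hT₂, h₂⟩ := card_returnCell_approx 0 hR hb hint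
  have hV := volume_real_pos_of_interior hb hint
  set V := volume.real R with hVdef
  -- Above T the denominator is at least t^d V / 2. Up to T both ratios lie in [0, 1], and the bound
  -- T / t ≥ 1 is enough.
  set T := T₁ + T₂ + 2 * (C₂ + 1) / V with hT
  have hTpos : 0 < T := by positivity
  refine ⟨T + 2 * (C₁ + C₂ + 2) / V, by positivity, fun t w j M F c ht hM hF hc hc' hcM => ?_⟩
  have ht0 : 0 < t := by linarith
  set v := volume.real (returnCell R (t⁻¹ • w) j) with hv
  have hv0 : 0 ≤ v := measureReal_nonneg
  have hvV : v ≤ V := measureReal_mono (returnCell_subset _ _ _) hb.measure_lt_top.ne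
  have hq0 : 0 ≤ v / V := by positivity
  have hq1 : v / V ≤ 1 := (div_le_one hV).2 hvV
  set m := M.card - 1 with hm
  rcases le_or_gt t T with hle | hlt
  · have h0 : (0 : ℝ) ≤ (c : ℝ) / (m : ℝ) := by positivity
    have h1 : (c : ℝ) / (m : ℝ) ≤ 1 := div_le_one_of_le₀ (by exact_mod_cast hcM) (by positivity)
    have h2 : 1 ≤ T / t := (one_le_div ht0).2 hle
    have h3 : T / t ≤ (T + 2 * (C₁ + C₂ + 2) / V) / t := by
      gcongr
      have : 0 ≤ 2 * (C₁ + C₂ + 2) / V := by positivity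
      linarith
    rw [abs_le]
    constructor <;> linarith
  · have hpos1 : 0 < 2 * (C₂ + 1) / V := by positivity
    have e1 := h₁ t w j F (by linarith) hF
    have e2 := h₂ t 0 0 M (by linarith) (fun n => by
      rw [hM]
      simp [returnCell, Fin.last])
    have hcell : returnCell R (t⁻¹ • (0 : Fin (0 + 1) → Fin d → ℝ)) 0 = R := by
      ext x
      simp [returnCell, Fin.last]
    rw [hcell] at e2
    set D := t ^ d / t with hD
    have hd0 : 0 < t ^ d := by positivity
    have hDpos : 0 < D := by positivity
    have hDt : t ^ d = D * t := by rw [hD]; field_simp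
    -- Since d ≥ 1, the errors of one point in c and in M.card - 1 are absorbed by D = t^(d-1).
    have hD1 : 1 ≤ D := by
      rw [hD, one_le_div ht0]
      exact le_self_pow₀ ht.le (by omega)
    rw [abs_le] at e1 e2
    have hMm : ((M.card : ℕ) : ℝ) - 1 ≤ m ∧ (m : ℝ) ≤ M.card := by
      constructor
      · have : M.card ≤ m + 1 := by omega
        have : (M.card : ℝ) ≤ m + 1 := by exact_mod_cast this
        linarith
      · exact_mod_cast Nat.sub_le _ _
    have hc1 : (c : ℝ) ≤ F.card := by exact_mod_cast hc
    have hc2 : (F.card : ℝ) ≤ c + 1 := by exact_mod_cast hc'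
    have hmlow : t ^ d * V / 2 ≤ m := by
      have : (C₂ + 1) * D ≤ t ^ d * V / 2 := by
        have h5 : 2 * (C₂ + 1) / V ≤ t := by linarith
        rw [div_le_iff₀ hV] at h5
        rw [hDt]
        nlinarith
      nlinarith
    have hmpos : (0 : ℝ) < m := lt_of_lt_of_le (by positivity) hmlow
    have hnum : |(c : ℝ) - v / V * m| ≤ (C₁ + C₂ + 2) * D := by
      have a1 : |(c : ℝ) - t ^ d * v| ≤ (C₁ + 1) * D := by
        rw [abs_le]; constructor <;> nlinarith
      have a2 : |t ^ d * V - m| ≤ (C₂ + 1) * D := by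
        rw [abs_le]; constructor <;> nlinarith
      have a3 : (c : ℝ) - v / V * m = (c - t ^ d * v) + v / V * (t ^ d * V - m) := by
        field_simp; ring
      rw [a3]
      refine (abs_add_le _ _).trans ?_
      rw [abs_mul, abs_of_nonneg hq0]
      have := mul_le_mul hq1 a2 (abs_nonneg _) zero_le_one
      linarith
    have hfin : (c : ℝ) / m - v / V = (c - v / V * m) / m := by
      field_simp
    rw [hfin, abs_div, abs_of_pos hmpos]
    calc _ ≤ (C₁ + C₂ + 2) * D / (t ^ d * V / 2) := by gcongr
      _ = (2 * (C₁ + C₂ + 2) / V) / t := by rw [hDt]; field_simp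
      _ ≤ _ := by gcongr; linarith

end ReturnCells

/-! ### Spacings of fractional parts -/

section Spacing

variable {d : ℕ} {ω : Fin d → ℝ} {R : Set (Fin d → ℝ)}

theorem mem_fracPoints {hR : Bornology.IsBounded R} {t y : ℝ} :
    y ∈ fracPoints ω hR t ↔
      ∃ m ∈ latticePoints R t, Int.fract (∑ i, (m i : ℝ) * ω i) = y := by
  simp [fracPoints]

theorem orderedPoint_mem (hR : Bornology.IsBounded R) (t : ℝ)
    (i : Fin (fracPoints ω hR t).card) : orderedPoint ω hR t i ∈ fracPoints ω hR t :=
  Finset.orderEmbOfFin_mem _ _ _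

theorem orderedPoint_strictMono (hR : Bornology.IsBounded R) (t : ℝ) :
    StrictMono (orderedPoint ω hR t) :=
  ((fracPoints ω hR t).orderEmbOfFin rfl).strictMono

theorem exists_orderedPoint_eq (hR : Bornology.IsBounded R) {t y : ℝ}
    (hy : y ∈ fracPoints ω hR t) : ∃ i, orderedPoint ω hR t i = y := by
  have := Finset.range_orderEmbOfFin (fracPoints ω hR t) rfl
  have h2 : y ∈ Set.range ((fracPoints ω hR t).orderEmbOfFin rfl) := by
    rw [this]; exact hy
  exact h2

theorem spacing_pos (hR : Bornology.IsBounded R) (t : ℝ)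
    (i : Fin ((fracPoints ω hR t).card - 1)) : 0 < spacing ω hR t i :=
  sub_pos.2 (orderedPoint_strictMono hR t (Fin.mk_lt_mk.2 (Nat.lt_succ_self _)))

/-- There is no point strictly inside a spacing. -/
theorem spacing_le_sub (hR : Bornology.IsBounded R) (t : ℝ)
    (i : Fin ((fracPoints ω hR t).card - 1)) {y : ℝ} (hy : y ∈ fracPoints ω hR t)
    (hlt : orderedPoint ω hR t ⟨i, by omega⟩ < y) :
    spacing ω hR t i ≤ y - orderedPoint ω hR t ⟨i, by omega⟩ := by
  obtain ⟨k, rfl⟩ := exists_orderedPoint_eq hR hy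
  have h1 := (orderedPoint_strictMono hR t).lt_iff_lt.1 hlt
  refine sub_le_sub_right ((orderedPoint_strictMono hR t).monotone ?_) _
  rw [Fin.lt_def] at h1
  rw [Fin.le_def]
  exact h1

theorem orderedPoint_mem_Ico (hR : Bornology.IsBounded R) (t : ℝ)
    (i : Fin (fracPoints ω hR t).card) : orderedPoint ω hR t i ∈ Set.Ico (0 : ℝ) 1 := by
  obtain ⟨m, -, h⟩ := mem_fracPoints.1 (orderedPoint_mem (ω := ω) hR t i)
  rw [← h]
  exact ⟨Int.fract_nonneg _, Int.fract_lt_one _⟩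

theorem spacing_lt_one (hR : Bornology.IsBounded R) (t : ℝ)
    (i : Fin ((fracPoints ω hR t).card - 1)) : spacing ω hR t i < 1 := by
  have h1 := (orderedPoint_mem_Ico (ω := ω) hR t ⟨i + 1, by omega⟩).2
  have h2 := (orderedPoint_mem_Ico (ω := ω) hR t ⟨i, by omega⟩).1
  unfold spacing
  linarith

/-- The lattice point whose fractional part is the `i`-th ordered point. -/
noncomputable def orderedLatticePoint (ω : Fin d → ℝ) (hR : Bornology.IsBounded R) (t : ℝ)
    (i : Fin (fracPoints ω hR t).card) : Fin d → ℤ :=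
  (mem_fracPoints.1 (orderedPoint_mem (ω := ω) hR t i)).choose

theorem orderedLatticePoint_mem (hR : Bornology.IsBounded R) (t : ℝ)
    (i : Fin (fracPoints ω hR t).card) :
    orderedLatticePoint ω hR t i ∈ latticePoints R t :=
  (mem_fracPoints.1 (orderedPoint_mem (ω := ω) hR t i)).choose_spec.1

theorem fract_orderedLatticePoint (hR : Bornology.IsBounded R) (t : ℝ)
    (i : Fin (fracPoints ω hR t).card) :
    Int.fract (∑ k, (orderedLatticePoint ω hR t i k : ℝ) * ω k) = orderedPoint ω hR t i :=
  (mem_fracPoints.1 (orderedPoint_mem (ω := ω) hR t i)).choose_spec.2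

/-- The real number `n₀ + n₁ ω₁ + ⋯ + n_d ω_d`. -/
noncomputable def integerCombination (ω : Fin d → ℝ) (n : Fin (d + 1) → ℤ) : ℝ :=
  n 0 + ∑ i : Fin d, (n i.succ : ℝ) * ω i

theorem integerCombination_injective
    (hind : LinearIndependent ℚ (Fin.cons 1 ω : Fin (d + 1) → ℝ)) :
    Function.Injective (integerCombination ω) := by
  intro n n' h
  have hZ : LinearIndependent ℤ (Fin.cons 1 ω : Fin (d + 1) → ℝ) := hind.restrict_scalars' ℤ
  have key : ∀ n : Fin (d + 1) → ℤ,
      ∑ i, n i • (Fin.cons 1 ω : Fin (d + 1) → ℝ) i = integerCombination ω n := by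
    intro n
    simp [Fin.sum_univ_succ, integerCombination]
  have := Fintype.linearIndependent_iff.1 hZ (n - n') (by
    simp only [Pi.sub_apply, sub_smul, Finset.sum_sub_distrib, key, h, sub_self])
  ext i
  exact sub_eq_zero.1 (this i)

theorem fract_injective (hind : LinearIndependent ℚ (Fin.cons 1 ω : Fin (d + 1) → ℝ)) :
    Function.Injective fun m : Fin d → ℤ => Int.fract (∑ i, (m i : ℝ) * ω i) := by
  intro m m' h
  obtain ⟨z, hz⟩ := Int.fract_eq_fract.1 h
  have := integerCombination_injective hind (a₁ := Fin.cons 0 m) (a₂ := Fin.cons z m') (by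
    simp only [integerCombination, Fin.cons_zero, Fin.cons_succ, Int.cast_zero]
    linarith)
  exact (Fin.cons_injective2 this).2

theorem card_fracPoints (hind : LinearIndependent ℚ (Fin.cons 1 ω : Fin (d + 1) → ℝ))
    (hR : Bornology.IsBounded R) (t : ℝ) :
    (fracPoints ω hR t).card = (latticePoints_finite hR t).toFinset.card :=
  Finset.card_image_of_injective _ (fract_injective hind)

theorem mem_fracPoints_of_add (hR : Bornology.IsBounded R) {t : ℝ}
    {i : Fin (fracPoints ω hR t).card} {n : Fin (d + 1) → ℤ}
    (hmem : (orderedLatticePoint ω hR t i + fun k : Fin d => n k.succ) ∈ latticePoints R t)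
    (h0 : 0 ≤ orderedPoint ω hR t i + integerCombination ω n)
    (h1 : orderedPoint ω hR t i + integerCombination ω n < 1) :
    orderedPoint ω hR t i + integerCombination ω n ∈ fracPoints ω hR t := by
  refine mem_fracPoints.2 ⟨_, hmem, ?_⟩
  rw [Int.fract_eq_iff]
  refine ⟨h0, h1, ⌊∑ k, (orderedLatticePoint ω hR t i k : ℝ) * ω k⌋ - n 0, ?_⟩
  rw [← fract_orderedLatticePoint, ← Int.self_sub_floor]
  simp only [Pi.add_apply, Int.cast_add, add_mul, Finset.sum_add_distrib, integerCombination]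
  push_cast
  ring

/-- A spacing is an integer combination of `1, ω₁, …, ω_d` whose coefficients record the
displacement between the lattice points concerned. -/
theorem exists_spacing_eq (hR : Bornology.IsBounded R) (t : ℝ)
    (i : Fin ((fracPoints ω hR t).card - 1)) :
    ∃ n : Fin (d + 1) → ℤ, spacing ω hR t i = integerCombination ω n ∧
      (orderedLatticePoint ω hR t ⟨i, by omega⟩ + fun k : Fin d => n k.succ) =
        orderedLatticePoint ω hR t ⟨i + 1, by omega⟩ := by
  set a := orderedLatticePoint ω hR t ⟨i, by omega⟩ with ha
  set b := orderedLatticePoint ω hR t ⟨i + 1, by omega⟩ with hb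
  refine ⟨Fin.cons (⌊∑ k, (a k : ℝ) * ω k⌋ - ⌊∑ k, (b k : ℝ) * ω k⌋) (b - a), ?_, ?_⟩
  · unfold spacing
    rw [← fract_orderedLatticePoint, ← fract_orderedLatticePoint, ← ha, ← hb,
      ← Int.self_sub_floor, ← Int.self_sub_floor]
    simp only [integerCombination, Fin.cons_zero, Fin.cons_succ, Pi.sub_apply, Int.cast_sub,
      sub_mul, Finset.sum_sub_distrib]
    ring
  · ext k
    simp

theorem mem_latticePoints_add_iff {t : ℝ} {m v : Fin d → ℤ} :
    m + v ∈ latticePoints R t ↔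
      (fun k => (m k : ℝ)) + (fun k => (v k : ℝ)) ∈ t • R := by
  simp only [latticePoints, Set.mem_ofPred_eq, Pi.add_apply, Int.cast_add]
  rfl

variable {N : ℕ} {s : Fin (N + 1) → ℝ} {n : Fin (N + 1) → Fin (d + 1) → ℤ} {c t : ℝ}

/-- Independence over ℚ makes the label determine the displacement to the next point. A smaller
label whose displacement stayed in tR would produce a point strictly inside the gap. -/
theorem mem_returnCell_of_spacing_eq
    (hind : LinearIndependent ℚ (Fin.cons 1 ω : Fin (d + 1) → ℝ))
    (hR : Bornology.IsBounded R) (hc : 0 < c) (hs : StrictMono s) (hs0 : ∀ j, 0 < s j)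
    (hn : ∀ j, s j = c * integerCombination ω (n j))
    {i : Fin ((fracPoints ω hR t).card - 1)} {j : Fin (N + 1)}
    (h : c * spacing ω hR t i = s j) :
    (fun k => (orderedLatticePoint ω hR t ⟨i, by omega⟩ k : ℝ)) ∈
      returnCell (t • R) (fun j k => (n j k.succ : ℝ)) j := by
  obtain ⟨n', hn', hadd⟩ := exists_spacing_eq (ω := ω) hR t i
  have hnj : n' = n j := by
    apply integerCombination_injective hind
    rw [hn, hn'] at h
    exact mul_left_cancel₀ hc.ne' h
  subst hnj
  refine ⟨orderedLatticePoint_mem hR t _, fun _ => ?_, fun l hl hmem => ?_⟩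
  · rw [← mem_latticePoints_add_iff, hadd]
    exact orderedLatticePoint_mem hR t _
  · have hlt : integerCombination ω (n l) < spacing ω hR t i := by
      rw [hn']
      have := hs hl
      rw [hn, hn] at this
      exact lt_of_mul_lt_mul_left this hc.le
    have hpos : 0 < integerCombination ω (n l) := by
      have := hs0 l
      rw [hn] at this
      exact pos_of_mul_pos_right this hc.le
    have hy0 := (orderedPoint_mem_Ico (ω := ω) hR t ⟨i, by omega⟩).1
    have hy1 := (orderedPoint_mem_Ico (ω := ω) hR t ⟨i + 1, by omega⟩).2
    have hsp : spacing ω hR t i = orderedPoint ω hR t ⟨i + 1, by omega⟩ -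
      orderedPoint ω hR t ⟨i, by omega⟩ := rfl
    -- No reduction modulo 1 occurs: the new point lies below the right end of the gap, which is
    -- below 1.
    have := spacing_le_sub hR t i (mem_fracPoints_of_add hR (n := n l)
      (mem_latticePoints_add_iff.2 hmem) (by linarith) (by linarith)) (by linarith)
    linarith

/-- The converse is formal: every gap has some label, and distinct cells are disjoint. -/
theorem spacing_eq_iff_mem_returnCell
    (hind : LinearIndependent ℚ (Fin.cons 1 ω : Fin (d + 1) → ℝ))
    (hR : Bornology.IsBounded R) (hc : 0 < c) (hs : StrictMono s) (hs0 : ∀ j, 0 < s j)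
    (hn : ∀ j, s j = c * integerCombination ω (n j))
    (hlab : ∀ i, ∃ j, c * spacing ω hR t i = s j)
    (i : Fin ((fracPoints ω hR t).card - 1)) (j : Fin (N + 1)) :
    c * spacing ω hR t i = s j ↔
      (fun k => (orderedLatticePoint ω hR t ⟨i, by omega⟩ k : ℝ)) ∈
        returnCell (t • R) (fun j k => (n j k.succ : ℝ)) j := by
  refine ⟨mem_returnCell_of_spacing_eq hind hR hc hs hs0 hn, fun h => ?_⟩
  obtain ⟨l, hl⟩ := hlab i
  rw [hl, eq_of_mem_returnCell (mem_returnCell_of_spacing_eq hind hR hc hs hs0 hn hl) h]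

/-- The number of spacings with a given label agrees with the number of lattice points in the
corresponding cell, up to the last point. -/
theorem card_spacing_eq_bounds
    (hind : LinearIndependent ℚ (Fin.cons 1 ω : Fin (d + 1) → ℝ))
    (hR : Bornology.IsBounded R) (hc : 0 < c) (hs : StrictMono s) (hs0 : ∀ j, 0 < s j)
    (hn : ∀ j, s j = c * integerCombination ω (n j))
    (hlab : ∀ i, ∃ j, c * spacing ω hR t i = s j) (j : Fin (N + 1))
    {F : Finset (Fin d → ℤ)} (hF : ∀ m : Fin d → ℤ, m ∈ F ↔
      (fun k => (m k : ℝ)) ∈ returnCell (t • R) (fun j k => (n j k.succ : ℝ)) j) :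
    (Finset.univ.filter fun i => c * spacing ω hR t i = s j).card ≤ F.card ∧
      F.card ≤ (Finset.univ.filter fun i => c * spacing ω hR t i = s j).card + 1 := by
  classical
  have hiff := spacing_eq_iff_mem_returnCell hind hR hc hs hs0 hn hlab
  set f : Fin ((fracPoints ω hR t).card - 1) → Fin d → ℤ :=
    fun i => orderedLatticePoint ω hR t ⟨i, by omega⟩ with hf
  have hinj : Function.Injective f := by
    intro i i' h
    have h1 := fract_orderedLatticePoint (ω := ω) hR t ⟨i, by omega⟩
    have h2 := fract_orderedLatticePoint (ω := ω) hR t ⟨i', by omega⟩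
    have h3 : orderedLatticePoint ω hR t ⟨i, by omega⟩ =
      orderedLatticePoint ω hR t ⟨i', by omega⟩ := h
    rw [h3, h2] at h1
    have := (orderedPoint_strictMono hR t).injective h1
    simpa [Fin.ext_iff, eq_comm] using this
  rw [← Finset.card_image_of_injective _ hinj]
  constructor
  · refine Finset.card_le_card fun m hm => ?_
    obtain ⟨i, hi, rfl⟩ := Finset.mem_image.1 hm
    exact (hF _).2 ((hiff i j).1 (Finset.mem_filter.1 hi).2)
  · rcases Nat.eq_zero_or_pos (fracPoints ω hR t).card with h0 | h0
    · have : F = ∅ := by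
        refine Finset.eq_empty_of_forall_notMem fun m hm => ?_
        have hm' : m ∈ latticePoints R t := returnCell_subset _ _ _ ((hF m).1 hm)
        rw [Finset.card_eq_zero] at h0
        have : Int.fract (∑ i, (m i : ℝ) * ω i) ∈ fracPoints ω hR t :=
          mem_fracPoints.2 ⟨m, hm', rfl⟩
        simp [h0] at this
      simp [this]
    -- The point with the largest fractional part has no gap to its right, yet it lies in some cell;
    -- it is the only possible excess.
    · refine (Finset.card_le_card (t := insert
        (orderedLatticePoint ω hR t ⟨(fracPoints ω hR t).card - 1, by omega⟩) _)
        fun m hm => ?_).trans (Finset.card_insert_le _ _)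
      have hm' : m ∈ latticePoints R t := returnCell_subset _ _ _ ((hF m).1 hm)
      obtain ⟨i, hi⟩ := exists_orderedPoint_eq hR (mem_fracPoints (ω := ω).2 ⟨m, hm', rfl⟩)
      rw [← fract_orderedLatticePoint] at hi
      have hmi := fract_injective hind hi
      by_cases hlast : (i : ℕ) < (fracPoints ω hR t).card - 1
      · refine Finset.mem_insert_of_mem (Finset.mem_image.2 ⟨⟨i, hlast⟩, ?_, hmi⟩)
        refine Finset.mem_filter.2 ⟨Finset.mem_univ _, (hiff _ j).2 ?_⟩
        have := (hF m).1 hm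
        rw [← hmi] at this
        exact this
      · have : i = ⟨(fracPoints ω hR t).card - 1, by omega⟩ := by
          ext
          have := i.2
          simp only
          omega
        rw [← hmi, this]
        exact Finset.mem_insert_self _ _

end Spacing

/-! ### Number fields: coordinates, lattices and units -/

section NumberTheory

open NumberField NumberField.Units

variable {K : Type*} [Field K] [NumberField K] {ι : Type*} [Fintype ι]

/-- Coordinates with respect to a basis are linear combinations of the complex embeddings. -/
theorem exists_repr_eq_sum_embeddings (e : Module.Basis ι ℚ K) :
    ∃ κ : ι → (K →+* ℂ) → ℂ, ∀ x i, ((e.repr x i : ℚ) : ℂ) = ∑ σ, κ i σ * σ x := by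
  classical
  -- The i-th coordinate of x is the trace of x times the i-th dual basis vector, and the trace is
  -- the sum over all embeddings.
  set f := (Algebra.traceForm ℚ K).dualBasis (traceForm_nondegenerate ℚ K) e with hf
  refine ⟨fun i σ => σ (f i), fun x i => ?_⟩
  have h1 : e.repr x i = Algebra.trace ℚ K (f i * x) := by
    have : ∀ j, Algebra.trace ℚ K (f i * (e.repr x j • e j)) =
        e.repr x j * (if j = i then 1 else 0) := by
      intro j
      rw [mul_smul_comm, map_smul, smul_eq_mul,
        ← LinearMap.BilinForm.apply_dualBasis_left (traceForm_nondegenerate ℚ K) e i j]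
      rfl
    conv_rhs => rw [← e.sum_repr x, Finset.mul_sum, map_sum]
    simp only [this, mul_ite, mul_one, mul_zero, Finset.sum_ite_eq', Finset.mem_univ, if_true]
  have h2 := trace_eq_sum_embeddings (K := ℚ) ℂ (x := f i * x)
  rw [h1]
  rw [eq_ratCast] at h2
  rw [h2, ← (RingHom.equivRatAlgHom K ℂ).sum_comp]
  exact Finset.sum_congr rfl fun σ _ => map_mul σ _ _

theorem exists_nat_mul_mem_span (e : Module.Basis ι ℚ K) (x : K) :
    ∃ n : ℕ, n ≠ 0 ∧ (n : K) * x ∈ Submodule.span ℤ (Set.range e) := by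
  refine ⟨∏ i, (e.repr x i).den, Finset.prod_ne_zero_iff.2 fun i _ => (e.repr x i).den_nz, ?_⟩
  rw [Module.Basis.mem_span_iff_repr_mem]
  intro i
  have h : ((∏ i, (e.repr x i).den : ℕ) : K) * x = ((∏ i, (e.repr x i).den : ℕ) : ℚ) • x := by
    rw [Algebra.smul_def, map_natCast]
  rw [h, map_smul, Finsupp.smul_apply, smul_eq_mul]
  obtain ⟨m, hm⟩ := Finset.dvd_prod_of_mem (fun i => (e.repr x i).den) (Finset.mem_univ i)
  refine ⟨m * (e.repr x i).num, ?_⟩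
  rw [hm]
  push_cast
  conv_rhs => rw [mul_right_comm, Rat.den_mul_eq_num]
  simp [mul_comm]

/-- Some positive integer multiplies every product of an algebraic integer and a lattice vector
into the lattice. -/
theorem exists_nat_mul_integer_mul_mem_span (e : Module.Basis ι ℚ K) :
    ∃ n : ℕ, n ≠ 0 ∧ ∀ (y : 𝓞 K) (x : K), x ∈ Submodule.span ℤ (Set.range e) →
      (n : K) * ((y : K) * x) ∈ Submodule.span ℤ (Set.range e) := by
  choose n hn0 hn using fun p : Module.Free.ChooseBasisIndex ℤ (𝓞 K) × ι =>
    exists_nat_mul_mem_span e ((RingOfIntegers.basis K p.1 : K) * e p.2)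
  refine ⟨∏ p, n p, Finset.prod_ne_zero_iff.2 fun p _ => hn0 p, fun y x hx => ?_⟩
  have base : ∀ i j, ((∏ p, n p : ℕ) : K) * ((RingOfIntegers.basis K i : K) * e j) ∈
      Submodule.span ℤ (Set.range e) := by
    intro i j
    obtain ⟨m, hm⟩ := Finset.dvd_prod_of_mem n (Finset.mem_univ (i, j))
    rw [hm]
    have := Submodule.smul_mem _ (m : ℤ) (hn (i, j))
    rw [zsmul_eq_mul] at this
    convert this using 1
    push_cast
    ring
  have step : ∀ j, ((∏ p, n p : ℕ) : K) * ((y : K) * e j) ∈ Submodule.span ℤ (Set.range e) := by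
    intro j
    have hy : (y : K) = ∑ i, ((RingOfIntegers.basis K).repr y i : K) *
        (RingOfIntegers.basis K i : K) := by
      have := congrArg (algebraMap (𝓞 K) K) ((RingOfIntegers.basis K).sum_repr y)
      rw [map_sum] at this
      refine this.symm.trans (Finset.sum_congr rfl fun i _ => ?_)
      rw [zsmul_eq_mul, map_mul, map_intCast]
    rw [hy, Finset.sum_mul, Finset.mul_sum]
    refine Submodule.sum_mem _ fun i _ => ?_
    have := Submodule.smul_mem _ ((RingOfIntegers.basis K).repr y i) (base i j)
    rw [zsmul_eq_mul] at this
    convert this using 1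
    ring
  induction hx using Submodule.span_induction with
  | mem x hx =>
    obtain ⟨j, rfl⟩ := hx
    exact step j
  | zero => simp
  | add x x' _ _ h h' =>
    rw [mul_add, mul_add]
    exact add_mem h h'
  | smul a x _ h =>
    rw [mul_smul_comm, mul_smul_comm]
    exact Submodule.smul_mem _ _ h

/-- A positive power of any unit preserves the lattice spanned by a basis. -/
theorem exists_pow_mul_mem_span (e : Module.Basis ι ℚ K) (η : (𝓞 K)ˣ) :
    ∃ k : ℕ, 0 < k ∧ ∀ l : ℤ, ∀ x ∈ Submodule.span ℤ (Set.range e),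
      (((η ^ k) ^ l : (𝓞 K)ˣ) : K) * x ∈ Submodule.span ℤ (Set.range e) := by
  obtain ⟨n, hn0, hn⟩ := exists_nat_mul_integer_mul_mem_span e
  set I : Ideal (𝓞 K) := Ideal.span {(n : 𝓞 K)} with hI
  have hI0 : I ≠ ⊥ := by
    rw [hI, Ne, Ideal.span_singleton_eq_bot]
    exact_mod_cast hn0
  have : Finite (𝓞 K ⧸ I) := Ideal.finiteQuotientOfFreeOfNeBot I hI0
  -- Units of the finite ring 𝓞 K / n have finite order, so all powers of η ^ k have the form 1 + n
  -- y, and n y maps the lattice into itself.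
  obtain ⟨k, hk, hk1⟩ := (isOfFinOrder_of_finite
    (Units.map (Ideal.Quotient.mk I : 𝓞 K →* 𝓞 K ⧸ I) η)).exists_pow_eq_one
  refine ⟨k, hk, fun l x hx => ?_⟩
  have h1 : Units.map (Ideal.Quotient.mk I : 𝓞 K →* 𝓞 K ⧸ I) ((η ^ k) ^ l) = 1 := by
    rw [map_zpow, map_pow, hk1, one_zpow]
  have h2 : (Ideal.Quotient.mk I) (((η ^ k) ^ l : (𝓞 K)ˣ) : 𝓞 K) = Ideal.Quotient.mk I 1 := by
    have := congrArg Units.val h1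
    rw [map_one]
    exact this
  rw [Ideal.Quotient.eq, hI, Ideal.mem_span_singleton] at h2
  obtain ⟨y, hy⟩ := h2
  have h3 : (((η ^ k) ^ l : (𝓞 K)ˣ) : K) = 1 + (n : K) * (y : K) := by
    have h4 := congrArg (algebraMap (𝓞 K) K) (sub_eq_iff_eq_add'.1 hy)
    rw [map_add, map_mul, map_one, map_natCast] at h4
    exact h4
  rw [h3, add_mul, one_mul, mul_assoc]
  exact add_mem hx (hn y x hx)

/-- Real exponents for the fundamental units with prescribed absolute values: expanding at one real
embedding and contracting by a common factor at all the others. -/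
theorem exists_exponents_fundSystem {σ₀ : K →+* ℂ} (hσ₀ : ComplexEmbedding.IsReal σ₀) :
    ∃ β : Fin (rank K) → ℝ,
      ∑ b, β b * Real.log ‖σ₀ (fundSystem K b : K)‖ = (Module.finrank ℚ K : ℝ) - 1 ∧
      ∀ σ : K →+* ℂ, σ ≠ σ₀ → ∑ b, β b * Real.log ‖σ (fundSystem K b : K)‖ = -1 := by
  classical
  set B := basisOfIsMaxRank (isMaxRank_fundSystem K)
  set w₁ := InfinitePlace.mk σ₀ with hw₁
  set c : InfinitePlace K → ℝ := fun w => if w = w₁ then (Module.finrank ℚ K : ℝ) - 1 else -1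
    with hc
  have hm : (w₁.mult : ℝ) = 1 := by
    rw [(InfinitePlace.isReal_mk_iff.2 hσ₀).mult_eq_one, Nat.cast_one]
  -- The prescribed logarithms satisfy the product formula: the place of σ₀ is real, and the
  -- multiplicities add up to the degree.
  have hsum : ∑ w : InfinitePlace K, (w.mult : ℝ) * c w = 0 := by
    have h1 : ∀ w : InfinitePlace K, (w.mult : ℝ) * c w =
        (if w = w₁ then (w.mult : ℝ) * Module.finrank ℚ K else 0) - w.mult := by
      intro w
      simp only [hc]
      split_ifs <;> ring
    simp only [h1, Finset.sum_sub_distrib, Finset.sum_ite_eq', Finset.mem_univ, if_true, hm]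
    have := InfinitePlace.sum_mult_eq (K := K)
    rw [← Nat.cast_sum, this]
    ring
  set β := B.repr fun w => (w.1.mult : ℝ) * c w.1 with hβ
  refine ⟨β, ?_⟩
  have hne : ∀ w : InfinitePlace K, w ≠ dirichletUnitTheorem.w₀ →
      (w.mult : ℝ) * ∑ b, β b * Real.log (w (fundSystem K b : K)) = w.mult * c w := by
    intro w hw
    have := congrFun (B.sum_repr fun w => (w.1.mult : ℝ) * c w.1) ⟨w, hw⟩
    rw [Finset.sum_apply] at this
    rw [← this, Finset.mul_sum]
    refine Finset.sum_congr rfl fun b _ => ?_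
    rw [Pi.smul_apply, basisOfIsMaxRank_apply, dirichletUnitTheorem.logEmbedding_component,
      smul_eq_mul]
    simp only [hβ]
    ring
  -- The logarithmic embedding omits the place `w₀`; the product formula recovers the value there.
  have hw0 : (dirichletUnitTheorem.w₀ (K := K)).mult *
      ∑ b, β b * Real.log ((dirichletUnitTheorem.w₀ (K := K)) (fundSystem K b : K)) =
      (dirichletUnitTheorem.w₀ (K := K)).mult * c dirichletUnitTheorem.w₀ := by
    have h1 : ∑ w : InfinitePlace K,
        (w.mult : ℝ) * ∑ b, β b * Real.log (w (fundSystem K b : K)) = 0 := by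
      have : ∀ w : InfinitePlace K,
          (w.mult : ℝ) * ∑ b, β b * Real.log (w (fundSystem K b : K)) =
          ∑ b, β b * (w.mult * Real.log (w (fundSystem K b : K))) := by
        intro w
        rw [Finset.mul_sum]
        exact Finset.sum_congr rfl fun b _ => by ring
      simp only [this]
      rw [Finset.sum_comm]
      refine Finset.sum_eq_zero fun b _ => ?_
      rw [← Finset.mul_sum, sum_mult_mul_log, mul_zero]
    rw [← Finset.add_sum_erase _ _ (Finset.mem_univ dirichletUnitTheorem.w₀)] at h1 hsum
    rw [Finset.sum_congr rfl fun w hw => hne w (Finset.ne_of_mem_erase hw)] at h1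
    linarith
  have hall : ∀ w : InfinitePlace K, ∑ b, β b * Real.log (w (fundSystem K b : K)) = c w := by
    intro w
    apply mul_left_cancel₀ (InfinitePlace.mult_coe_ne_zero (w := w))
    by_cases hw : w = dirichletUnitTheorem.w₀
    · rw [hw]; exact hw0
    · exact hne w hw
  have hσ : ∀ σ : K →+* ℂ, ∑ b, β b * Real.log ‖σ (fundSystem K b : K)‖ =
      c (InfinitePlace.mk σ) := fun σ => by
    rw [← hall]
    simp only [InfinitePlace.apply]
  refine ⟨by rw [hσ, ← hw₁]; exact if_pos rfl, fun σ hne' => ?_⟩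
  rw [hσ]
  refine if_neg fun h => hne' ?_
  rw [hw₁, eq_comm, InfinitePlace.mk_eq_iff, ComplexEmbedding.isReal_iff.1 hσ₀, or_self] at h
  exact h.symm

/-- Fundamental units are replaced by powers that preserve the lattice, then squared so as to be
positive at real embeddings. Dividing the exponents by 2k keeps the logarithmic sums. -/
theorem exists_units_and_exponents {σ₀ : K →+* ℂ} (hσ₀ : ComplexEmbedding.IsReal σ₀)
    (e : Module.Basis ι ℚ K) :
    ∃ (ε : Fin (rank K) → (𝓞 K)ˣ) (β : Fin (rank K) → ℝ),
      (∀ b, IsSquare (ε b)) ∧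
      (∀ b, ∀ l : ℤ, ∀ x ∈ Submodule.span ℤ (Set.range e),
        ((ε b ^ l : (𝓞 K)ˣ) : K) * x ∈ Submodule.span ℤ (Set.range e)) ∧
      ∑ b, β b * Real.log ‖σ₀ (ε b : K)‖ = (Module.finrank ℚ K : ℝ) - 1 ∧
      ∀ σ : K →+* ℂ, σ ≠ σ₀ → ∑ b, β b * Real.log ‖σ (ε b : K)‖ = -1 := by
  obtain ⟨β, hβ₀, hβ⟩ := exists_exponents_fundSystem hσ₀
  choose k hk hkL using fun b => exists_pow_mul_mem_span e (fundSystem K b)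
  have hlog : ∀ σ : K →+* ℂ,
      ∑ b, β b / (2 * k b) * Real.log ‖σ (((fundSystem K b ^ k b) ^ 2 : (𝓞 K)ˣ) : K)‖ =
        ∑ b, β b * Real.log ‖σ (fundSystem K b : K)‖ := fun σ => by
    refine Finset.sum_congr rfl fun b _ => ?_
    have hk0 : (k b : ℝ) ≠ 0 := Nat.cast_ne_zero.2 (hk b).ne'
    push_cast
    rw [map_pow, map_pow, norm_pow, norm_pow, Real.log_pow, Real.log_pow]
    push_cast
    field_simp
  refine ⟨fun b => (fundSystem K b ^ k b) ^ 2, fun b => β b / (2 * k b),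
    fun b => (even_two.isSquare_pow _), fun b l x hx => ?_, (hlog σ₀).trans hβ₀,
    fun σ hσ => (hlog σ).trans (hβ σ hσ)⟩
  have := hkL b (2 * l) x hx
  rwa [zpow_mul, zpow_ofNat] at this

end NumberTheory

/-! ### A quasiperiodic family of units -/

section UnitFlow

open NumberField NumberField.Units

variable {K : Type*} [Field K] [NumberField K] {ι : Type*} [Fintype ι]

/-- A family of units preserving the lattice spanned by `e`, of size about `t ^ d` at the real
embedding `σ₀` and of size about `t⁻¹` at the others, which up to bounded quasiperiodic factors is
a one-parameter group. -/
structure UnitFlow (σ₀ : K →+* ℂ) (e : Module.Basis ι ℚ K) (d : ℕ) where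
  unit : ℝ → (𝓞 K)ˣ
  exponent : Fin (rank K) → ℝ
  frequency : (K →+* ℂ) → ℝ
  logarithm : (K →+* ℂ) → Fin (rank K) → ℂ
  bound : ℝ
  one_le_bound : 1 ≤ bound
  isSquare_unit : ∀ t, IsSquare (unit t)
  unit_mul_mem : ∀ t, ∀ x ∈ Submodule.span ℤ (Set.range e),
    (unit t : K) * x ∈ Submodule.span ℤ (Set.range e)
  inv_mul_mem : ∀ t, ∀ x ∈ Submodule.span ℤ (Set.range e),
    (unit t : K)⁻¹ * x ∈ Submodule.span ℤ (Set.range e)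
  norm_le_pow : ∀ t, 0 < t → ‖σ₀ (unit t : K)‖ ≤ bound * t ^ d
  inv_norm_le_pow : ∀ t, 0 < t → ‖σ₀ (unit t : K)‖⁻¹ ≤ bound / t ^ d
  norm_le : ∀ t, 0 < t → ∀ σ : K →+* ℂ, σ ≠ σ₀ → ‖σ (unit t : K)‖ ≤ bound / t
  inv_norm_le : ∀ t, 0 < t → ∀ σ : K →+* ℂ, σ ≠ σ₀ → ‖σ (unit t : K)‖⁻¹ ≤ bound * t
  inv_eq : ∀ t : ℝ, 0 < t → ∀ σ : K →+* ℂ, σ ≠ σ₀ →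
    (t : ℂ)⁻¹ * (σ (unit t : K))⁻¹ =
      AddCircle.toCircle ((frequency σ * Real.log t : ℝ) : UnitAddCircle) *
        Complex.exp (∑ b, ((fracUnit (exponent b * Real.log t) : ℝ) : ℂ) * logarithm σ b)

theorem toCircle_coe_unitAddCircle (x : ℝ) :
    (AddCircle.toCircle (x : UnitAddCircle) : ℂ) = Complex.exp (2 * Real.pi * x * Complex.I) := by
  rw [AddCircle.toCircle_apply_mk, Circle.coe_exp]
  push_cast
  simp

/-- Write ⌊βx⌋ = βx - {βx}. The linear part contributes growth through log |z| and a character of x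
through arg z; the fractional parts contribute a bounded amplitude. -/
theorem inv_prod_zpow_floor_eq {κ : Type*} [Fintype κ] (z : κ → ℂ) (hz : ∀ b, z b ≠ 0)
    (β : κ → ℝ) {w : ℝ} (hw : ∑ b, β b * Real.log ‖z b‖ = w) (x : ℝ) :
    (∏ b, z b ^ ⌊β b * x⌋)⁻¹ = Complex.exp (-(w * x)) *
      (AddCircle.toCircle ((-(∑ b, β b * (z b).arg) / (2 * Real.pi) * x : ℝ) : UnitAddCircle) *
        Complex.exp (∑ b, ((fracUnit (β b * x) : ℝ) : ℂ) * Complex.log (z b))) := by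
  have h1 : ∏ b, z b ^ ⌊β b * x⌋ =
      Complex.exp (∑ b, (⌊β b * x⌋ : ℂ) * Complex.log (z b)) := by
    rw [Complex.exp_sum]
    refine Finset.prod_congr rfl fun b _ => ?_
    rw [Complex.exp_int_mul, Complex.exp_log (hz b)]
  rw [h1, ← Complex.exp_neg, toCircle_coe_unitAddCircle, ← Complex.exp_add, ← Complex.exp_add]
  congr 1
  have h2 : ∀ b, ((fracUnit (β b * x) : ℝ) : ℂ) = β b * x - (⌊β b * x⌋ : ℂ) := by
    intro b
    have : (fracUnit (β b * x) : ℝ) = β b * x - ⌊β b * x⌋ := (Int.self_sub_floor _).symm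
    rw [this]
    push_cast
    rfl
  have h3 : ∑ b, (β b : ℂ) * Complex.log (z b) =
      w + (∑ b, β b * (z b).arg : ℝ) * Complex.I := by
    rw [← hw]
    push_cast
    rw [Finset.sum_mul, ← Finset.sum_add_distrib]
    refine Finset.sum_congr rfl fun b _ => ?_
    rw [Complex.log]
    ring
  have h4 : ∑ b, ((fracUnit (β b * x) : ℝ) : ℂ) * Complex.log (z b) =
      x * ∑ b, (β b : ℂ) * Complex.log (z b) - ∑ b, (⌊β b * x⌋ : ℂ) * Complex.log (z b) := by
    rw [Finset.mul_sum, ← Finset.sum_sub_distrib]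
    refine Finset.sum_congr rfl fun b _ => ?_
    rw [h2]
    ring
  rw [h4, h3]
  generalize ∑ b, (⌊β b * x⌋ : ℂ) * Complex.log (z b) = Z
  have hpi : (Real.pi : ℂ) ≠ 0 := by exact_mod_cast Real.pi_ne_zero
  push_cast
  field_simp
  ring

theorem norm_exp_sum_fracUnit_bounds {κ : Type*} [Fintype κ] (x : κ → ℝ) (l : κ → ℂ) :
    ‖Complex.exp (∑ b, ((fracUnit (x b) : ℝ) : ℂ) * l b)‖ ≤ Real.exp (∑ b, ‖l b‖) ∧
    ‖Complex.exp (∑ b, ((fracUnit (x b) : ℝ) : ℂ) * l b)‖⁻¹ ≤ Real.exp (∑ b, ‖l b‖) := by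
  have h : ‖∑ b, ((fracUnit (x b) : ℝ) : ℂ) * l b‖ ≤ ∑ b, ‖l b‖ := by
    refine norm_sum_le_of_le _ fun b _ => ?_
    rw [norm_mul, Complex.norm_real, Real.norm_of_nonneg (fracUnit (x b)).2.1]
    exact mul_le_of_le_one_left (norm_nonneg _) (fracUnit (x b)).2.2
  have h2 := (Complex.abs_re_le_norm _).trans h
  rw [abs_le] at h2
  rw [Complex.norm_exp, ← Real.exp_neg]
  constructor <;> apply Real.exp_le_exp.2 <;> linarith

theorem nonempty_unitFlow {σ₀ : K →+* ℂ} (hσ₀ : ComplexEmbedding.IsReal σ₀)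
    (e : Module.Basis ι ℚ K) {d : ℕ} (hd : Module.finrank ℚ K = d + 1) :
    Nonempty (UnitFlow σ₀ e d) := by
  obtain ⟨ε, β, hsq, hL, hβ₀, hβ⟩ := exists_units_and_exponents hσ₀ e
  set u : ℝ → (𝓞 K)ˣ := fun t => ∏ b, ε b ^ ⌊β b * Real.log t⌋ with hu
  set l : (K →+* ℂ) → Fin (rank K) → ℂ := fun σ b => Complex.log (σ (ε b : K)) with hl
  have hσu : ∀ (σ : K →+* ℂ) t, σ (u t : K) = ∏ b, σ (ε b : K) ^ ⌊β b * Real.log t⌋ := by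
    intro σ t
    simp only [hu]
    have : ∀ s : Finset (Fin (rank K)), σ ((∏ b ∈ s, ε b ^ ⌊β b * Real.log t⌋ : (𝓞 K)ˣ) : K) =
        ∏ b ∈ s, σ (ε b : K) ^ ⌊β b * Real.log t⌋ := by
      intro s
      induction s using Finset.cons_induction with
      | empty => simp
      | cons a s ha ih =>
        rw [Finset.prod_cons, Finset.prod_cons, coe_mul, map_mul, ih, coe_zpow, map_zpow₀]
    exact this _
  have hε : ∀ (σ : K →+* ℂ) b, σ (ε b : K) ≠ 0 := fun σ b =>
    (map_ne_zero σ).2 (coe_ne_zero _)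
  have hinv : ∀ (σ : K →+* ℂ) (w : ℝ), ∑ b, β b * Real.log ‖σ (ε b : K)‖ = w → ∀ t,
      (σ (u t : K))⁻¹ = _ := fun σ w hw t =>
    (congrArg _ (hσu σ t)).trans
      (inv_prod_zpow_floor_eq (fun b => σ (ε b : K)) (hε σ) β hw (Real.log t))
  set c : ℝ := Real.exp (∑ σ, ∑ b, ‖l σ b‖) with hc
  have hlc : ∀ σ, Real.exp (∑ b, ‖l σ b‖) ≤ c := fun σ => Real.exp_le_exp.2
    (Finset.single_le_sum (f := fun σ => ∑ b, ‖l σ b‖)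
      (fun σ _ => Finset.sum_nonneg fun b _ => norm_nonneg _) (Finset.mem_univ σ))
  have hnorm : ∀ (σ : K →+* ℂ) (w : ℝ), ∑ b, β b * Real.log ‖σ (ε b : K)‖ = w → ∀ t,
      ‖σ (u t : K)‖ ≤ c * Real.exp (w * Real.log t) ∧
      ‖σ (u t : K)‖⁻¹ ≤ c * Real.exp (-(w * Real.log t)) := by
    intro σ w hw t
    obtain ⟨b1, b2⟩ := norm_exp_sum_fracUnit_bounds (fun b => β b * Real.log t) (l σ)
    have h := congrArg norm (hinv σ w hw t)
    rw [norm_inv, norm_mul, norm_mul, Circle.norm_coe, one_mul, Complex.norm_exp] at h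
    have h0 : (-((w : ℂ) * (Real.log t : ℂ))).re = -(w * Real.log t) := by
      simp
    rw [h0] at h
    constructor
    · rw [← inv_inv ‖σ (u t : K)‖, h, mul_inv, ← Real.exp_neg, neg_neg, mul_comm c]
      gcongr
      exact b2.trans (hlc σ)
    · rw [h, mul_comm c]
      gcongr
      exact b1.trans (hlc σ)
  have hexp : ∀ t : ℝ, 0 < t → Real.exp (((Module.finrank ℚ K : ℝ) - 1) * Real.log t) = t ^ d := by
    intro t ht
    rw [hd, Nat.cast_succ, add_sub_cancel_right, Real.exp_nat_mul, Real.exp_log ht]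
  refine ⟨⟨u, β, fun σ => -(∑ b, β b * (σ (ε b : K)).arg) / (2 * Real.pi), l, c, ?_, ?_, ?_, ?_,
    ?_, ?_, ?_, ?_, ?_⟩⟩
  · exact Real.one_le_exp (Finset.sum_nonneg fun σ _ => Finset.sum_nonneg fun b _ => norm_nonneg _)
  · intro t
    choose v hv using hsq
    refine ⟨∏ b, v b ^ ⌊β b * Real.log t⌋, ?_⟩
    rw [← Finset.prod_mul_distrib]
    refine Finset.prod_congr rfl fun b _ => ?_
    rw [hv b, mul_zpow]
  · intro t
    simp only [hu]
    have : ∀ s : Finset (Fin (rank K)), ∀ x ∈ Submodule.span ℤ (Set.range e),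
        ((∏ b ∈ s, ε b ^ ⌊β b * Real.log t⌋ : (𝓞 K)ˣ) : K) * x ∈
          Submodule.span ℤ (Set.range e) := by
      intro s
      induction s using Finset.cons_induction with
      | empty => simp
      | cons a s ha ih =>
        intro x hx
        rw [Finset.prod_cons, coe_mul, mul_assoc]
        exact hL _ _ _ (ih x hx)
    exact this _
  · intro t
    have : ∀ s : Finset (Fin (rank K)), ∀ x ∈ Submodule.span ℤ (Set.range e),
        ((∏ b ∈ s, ε b ^ ⌊β b * Real.log t⌋ : (𝓞 K)ˣ) : K)⁻¹ * x ∈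
          Submodule.span ℤ (Set.range e) := by
      intro s
      induction s using Finset.cons_induction with
      | empty => simp
      | cons a s ha ih =>
        intro x hx
        rw [Finset.prod_cons, coe_mul, mul_inv, mul_assoc]
        have := hL a (-⌊β a * Real.log t⌋) _ (ih x hx)
        have hi := coe_zpow (ε a ^ ⌊β a * Real.log t⌋) (-1)
        rw [zpow_neg_one, zpow_neg_one] at hi
        rwa [zpow_neg, hi] at this
    exact this _
  · intro t ht
    rw [← hexp t ht]
    exact (hnorm σ₀ _ hβ₀ t).1
  · intro t ht
    rw [← hexp t ht, div_eq_mul_inv, ← Real.exp_neg]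
    exact (hnorm σ₀ _ hβ₀ t).2
  · intro t ht σ hσ
    have := (hnorm σ _ (hβ σ hσ) t).1
    rwa [neg_one_mul, Real.exp_neg, Real.exp_log ht] at this
  · intro t ht σ hσ
    have := (hnorm σ _ (hβ σ hσ) t).2
    rwa [neg_one_mul, neg_neg, Real.exp_log ht] at this
  · intro t ht σ hσ
    rw [hinv σ _ (hβ σ hσ) t, ← mul_assoc]
    have : Complex.exp (-(((-1 : ℝ) : ℂ) * (Real.log t : ℂ))) = t := by
      push_cast
      rw [neg_one_mul, neg_neg, ← Complex.ofReal_exp, Real.exp_log ht]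
    rw [this, inv_mul_cancel₀ (by exact_mod_cast ht.ne'), one_mul]

end UnitFlow

/-! ### Rescaled spacings take finitely many values -/

section Labels

open NumberField NumberField.Units

variable {d : ℕ} {ω : Fin d → ℝ} {Φ : IntermediateField ℚ ℝ}

/-- The inclusion of a real number field in the complex numbers. -/
noncomputable def IntermediateField.realEmbedding (Φ : IntermediateField ℚ ℝ) : Φ →+* ℂ :=
  Complex.ofRealHom.comp (algebraMap Φ ℝ)

theorem IntermediateField.realEmbedding_apply (x : Φ) :
    Φ.realEmbedding x = ((x : ℝ) : ℂ) := rfl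

theorem IntermediateField.norm_realEmbedding (x : Φ) : ‖Φ.realEmbedding x‖ = |(x : ℝ)| := by
  rw [realEmbedding_apply, Complex.norm_real, Real.norm_eq_abs]

theorem IntermediateField.isReal_realEmbedding : ComplexEmbedding.IsReal Φ.realEmbedding := by
  rw [ComplexEmbedding.isReal_iff]
  ext x
  rw [ComplexEmbedding.conjugate_coe_eq, realEmbedding_apply, Complex.conj_ofReal]

theorem exists_basis_coe_eq
    (hind : LinearIndependent ℚ (Fin.cons 1 ω : Fin (d + 1) → ℝ))
    (hspan : Submodule.span ℚ (Set.range (Fin.cons 1 ω : Fin (d + 1) → ℝ)) =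
      Subalgebra.toSubmodule Φ.toSubalgebra) :
    ∃ e : Module.Basis (Fin (d + 1)) ℚ Φ, ∀ j, (e j : ℝ) = (Fin.cons 1 ω : Fin (d + 1) → ℝ) j := by
  have hmem : ∀ j, (Fin.cons 1 ω : Fin (d + 1) → ℝ) j ∈ Φ := by
    intro j
    have : (Fin.cons 1 ω : Fin (d + 1) → ℝ) j ∈ Subalgebra.toSubmodule Φ.toSubalgebra := by
      rw [← hspan]
      exact Submodule.subset_span ⟨j, rfl⟩
    exact this
  set v : Fin (d + 1) → Φ := fun j => ⟨_, hmem j⟩ with hv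
  set f : Φ →ₗ[ℚ] ℝ := Φ.val.toLinearMap with hf
  have hfv : f ∘ v = (Fin.cons 1 ω : Fin (d + 1) → ℝ) := rfl
  have hli : LinearIndependent ℚ v := by
    apply LinearIndependent.of_comp f
    rw [hfv]
    exact hind
  refine ⟨Module.Basis.mk hli ?_, fun j => by rw [Module.Basis.mk_apply]⟩
  intro x _
  have hx : f x ∈ Submodule.map f (Submodule.span ℚ (Set.range v)) := by
    rw [Submodule.map_span, ← Set.range_comp, hfv, hspan]
    exact x.2
  obtain ⟨y, hy, hyx⟩ := hx
  rwa [← Subtype.ext (a1 := y) (a2 := x) hyx]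

variable {e : Module.Basis (Fin (d + 1)) ℚ Φ}

theorem coe_sum_smul (he : ∀ j, (e j : ℝ) = (Fin.cons 1 ω : Fin (d + 1) → ℝ) j)
    (n : Fin (d + 1) → ℤ) : ((∑ j, n j • e j : Φ) : ℝ) = integerCombination ω n := by
  have : ((∑ j, n j • e j : Φ) : ℝ) = ∑ j, (n j : ℝ) * (e j : ℝ) := by
    have h := map_sum (algebraMap Φ ℝ) (fun j => n j • e j) Finset.univ
    refine h.trans (Finset.sum_congr rfl fun j _ => ?_)
    rw [map_zsmul, zsmul_eq_mul]
    rfl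
  rw [this]
  simp only [he, Fin.sum_univ_succ, Fin.cons_zero, Fin.cons_succ, mul_one, integerCombination]

theorem exists_eq_sum_smul {x : Φ} (hx : x ∈ Submodule.span ℤ (Set.range e)) :
    ∃ n : Fin (d + 1) → ℤ, x = ∑ j, n j • e j := by
  obtain ⟨n, hn⟩ := (Submodule.mem_span_range_iff_exists_fun ℤ).1 hx
  exact ⟨n, hn.symm⟩

theorem sum_smul_mem (e : Module.Basis (Fin (d + 1)) ℚ Φ) (n : Fin (d + 1) → ℤ) :
    ∑ j, n j • e j ∈ Submodule.span ℤ (Set.range e) :=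
  Submodule.sum_mem _ fun j _ => Submodule.smul_mem _ _ (Submodule.subset_span ⟨j, rfl⟩)

theorem repr_sum_smul (e : Module.Basis (Fin (d + 1)) ℚ Φ) (n : Fin (d + 1) → ℤ)
    (i : Fin (d + 1)) : e.repr (∑ j, n j • e j) i = n i := by
  have : ∑ j, n j • e j = ∑ j, (n j : ℚ) • e j :=
    Finset.sum_congr rfl fun j _ => (Int.cast_smul_eq_zsmul ℚ _ _).symm
  rw [this, e.repr_sum_self]

variable [NumberField Φ]

/-- Embeddings are bounded in terms of coordinates. -/
theorem exists_norm_embedding_le (e : Module.Basis (Fin (d + 1)) ℚ Φ) :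
    ∃ c : ℝ, 1 ≤ c ∧ ∀ (x : Φ) (B : ℝ), (∀ j, |((e.repr x j : ℚ) : ℝ)| ≤ B) →
      ∀ σ : Φ →+* ℂ, ‖σ x‖ ≤ c * B := by
  refine ⟨1 + ∑ σ : Φ →+* ℂ, ∑ j, ‖σ (e j)‖, ?_, fun x B hB σ => ?_⟩
  · have : 0 ≤ ∑ σ : Φ →+* ℂ, ∑ j, ‖σ (e j)‖ :=
      Finset.sum_nonneg fun σ _ => Finset.sum_nonneg fun j _ => norm_nonneg _
    linarith
  · have hB0 : 0 ≤ B := (abs_nonneg _).trans (hB 0)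
    have h1 : ‖σ x‖ ≤ (∑ j, ‖σ (e j)‖) * B := by
      conv_lhs => rw [← e.sum_repr x]
      rw [map_sum, Finset.sum_mul]
      refine norm_sum_le_of_le _ fun j _ => ?_
      rw [Algebra.smul_def, map_mul, eq_ratCast, map_ratCast, norm_mul, mul_comm]
      have : ‖((e.repr x j : ℚ) : ℂ)‖ = |((e.repr x j : ℚ) : ℝ)| := by
        rw [← Complex.ofReal_ratCast, Complex.norm_real, Real.norm_eq_abs]
      rw [this]
      gcongr
      exact hB j
    refine h1.trans (mul_le_mul_of_nonneg_right ?_ hB0)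
    have := Finset.single_le_sum (f := fun σ : Φ →+* ℂ => ∑ j, ‖σ (e j)‖)
      (fun σ _ => Finset.sum_nonneg fun j _ => norm_nonneg _) (Finset.mem_univ σ)
    linarith

/-- Coordinates are bounded in terms of embeddings. -/
theorem exists_abs_repr_le (e : Module.Basis (Fin (d + 1)) ℚ Φ) :
    ∃ c : ℝ, 0 ≤ c ∧ ∀ (x : Φ) (B : ℝ), (∀ σ : Φ →+* ℂ, ‖σ x‖ ≤ B) →
      ∀ j, |((e.repr x j : ℚ) : ℝ)| ≤ c * B := by
  obtain ⟨κ, hκ⟩ := exists_repr_eq_sum_embeddings e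
  refine ⟨∑ j, ∑ σ, ‖κ j σ‖,
    Finset.sum_nonneg fun j _ => Finset.sum_nonneg fun σ _ => norm_nonneg _, fun x B hB j => ?_⟩
  have hB0 : 0 ≤ B := (norm_nonneg _).trans (hB Φ.realEmbedding)
  have h1 : |((e.repr x j : ℚ) : ℝ)| ≤ (∑ σ, ‖κ j σ‖) * B := by
    rw [← Real.norm_eq_abs, ← Complex.norm_real, Complex.ofReal_ratCast, hκ, Finset.sum_mul]
    refine norm_sum_le_of_le _ fun σ _ => ?_
    rw [norm_mul]
    gcongr
    exact hB σ
  refine h1.trans (mul_le_mul_of_nonneg_right ?_ hB0)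
  exact Finset.single_le_sum (f := fun j => ∑ σ, ‖κ j σ‖)
    (fun j _ => Finset.sum_nonneg fun σ _ => norm_nonneg _) (Finset.mem_univ j)

/-- Being a square, the unit is positive, so rescaling by it preserves the order of gaps. -/
theorem UnitFlow.unit_pos (U : UnitFlow Φ.realEmbedding e d)
    (t : ℝ) : 0 < (((U.unit t : 𝓞 Φ) : Φ) : ℝ) := by
  obtain ⟨v, hv⟩ := U.isSquare_unit t
  have h : (((U.unit t : 𝓞 Φ) : Φ) : ℝ) = (((v : 𝓞 Φ) : Φ) : ℝ) * (((v : 𝓞 Φ) : Φ) : ℝ) := by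
    rw [hv]
    push_cast
    rfl
  rw [h]
  have : (((v : 𝓞 Φ) : Φ) : ℝ) ≠ 0 := by
    exact fun h => coe_ne_zero v (Subtype.ext h)
  exact mul_self_pos.2 this

theorem UnitFlow.inv_norm_le_all (U : UnitFlow Φ.realEmbedding e d)
    {t : ℝ} (ht : 1 ≤ t) (σ : Φ →+* ℂ) :
    ‖σ (((U.unit t : 𝓞 Φ) : Φ)⁻¹)‖ ≤ U.bound * t := by
  have ht0 : 0 < t := by linarith
  have hb := U.one_le_bound
  rw [map_inv₀, norm_inv]
  by_cases hσ : σ = Φ.realEmbedding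
  · rw [hσ]
    refine (U.inv_norm_le_pow t ht0).trans ?_
    calc U.bound / t ^ d ≤ U.bound := div_le_self (by linarith) (one_le_pow₀ ht)
      _ ≤ U.bound * t := le_mul_of_one_le_right (by linarith) ht
  · exact U.inv_norm_le t ht0 σ hσ

/-- Very small positive integer combinations of `1, ω₁, …, ω_d` have coefficient vectors close to
any given point, on the appropriate scale. -/
theorem UnitFlow.exists_small_integerCombination (U : UnitFlow Φ.realEmbedding e d)
    (he : ∀ j, (e j : ℝ) = (Fin.cons 1 ω : Fin (d + 1) → ℝ) j) {ρ : ℝ} (hρ : 0 < ρ) :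
    ∃ B T : ℝ, 0 ≤ B ∧ 1 ≤ T ∧ ∀ t, T ≤ t → ∀ z : Fin d → ℝ, ∃ n : Fin (d + 1) → ℤ,
      0 < integerCombination ω n ∧ integerCombination ω n ≤ B / t ^ d ∧
      ‖(fun k : Fin d => (n k.succ : ℝ)) - z‖ ≤ ρ * t := by
  obtain ⟨c, hc1, hc⟩ := exists_norm_embedding_le e
  obtain ⟨A, hA0, hA⟩ := exists_abs_repr_le e
  have hb := U.one_le_bound
  -- The unit is taken at the smaller time τ = t / q, so that the rounding error, of order τ in each
  -- coordinate, is at most ρ t / 2. The other half of the tolerance is for the rational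
  -- approximation of z.
  set q : ℝ := 2 * (A * (U.bound * c)) / ρ + 1 with hq
  have hq1 : 1 ≤ q := by
    have : 0 ≤ 2 * (A * (U.bound * c)) / ρ := by positivity
    linarith
  refine ⟨3 * c * (U.bound * q ^ d), q, by positivity, hq1, fun t ht z => ?_⟩
  have ht0 : 0 < t := by linarith
  set τ := t / q with hτ
  have hτ1 : 1 ≤ τ := (one_le_div (by linarith)).2 ht
  set u : Φ := ((U.unit τ : 𝓞 Φ) : Φ) with hu
  have hu0 : (0 : ℝ) < (u : ℝ) := U.unit_pos τ
  have hune : u ≠ 0 := by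
    intro h
    rw [h] at hu0
    exact lt_irrefl _ hu0
  choose r hr using fun k : Fin d => exists_rat_near (z k) (ε := ρ / 2 * t) (by positivity)
  -- The free coordinate r₀ places u p between c and 2c. Rounding u p to the lattice changes it by
  -- at most c, so the result is positive and at most 3c.
  obtain ⟨r₀, hr₀, hr₀'⟩ := exists_rat_btwn
    (show c / (u : ℝ) - ∑ k, (r k : ℝ) * ω k < 2 * c / (u : ℝ) - ∑ k, (r k : ℝ) * ω k by
      have : c / (u : ℝ) < 2 * c / (u : ℝ) := by
        gcongr
        linarith
      linarith)
  set p : Φ := ∑ j, (Fin.cons r₀ r : Fin (d + 1) → ℚ) j • e j with hp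
  have hprepr : ∀ j, e.repr p j = (Fin.cons r₀ r : Fin (d + 1) → ℚ) j := fun j => by
    rw [hp, e.repr_sum_self]
  have hpval : (p : ℝ) = r₀ + ∑ k, (r k : ℝ) * ω k := by
    have h := map_sum (algebraMap Φ ℝ)
      (fun j => (Fin.cons r₀ r : Fin (d + 1) → ℚ) j • e j) Finset.univ
    have h2 : ∀ j, algebraMap Φ ℝ ((Fin.cons r₀ r : Fin (d + 1) → ℚ) j • e j) =
        ((Fin.cons r₀ r : Fin (d + 1) → ℚ) j : ℝ) * (Fin.cons 1 ω : Fin (d + 1) → ℝ) j := by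
      intro j
      rw [Algebra.smul_def, map_mul, ← he, eq_ratCast, map_ratCast]
      rfl
    refine (h.trans (Finset.sum_congr rfl fun j _ => h2 j)).trans ?_
    simp only [Fin.sum_univ_succ, Fin.cons_zero, Fin.cons_succ, mul_one]
  set n₁ : Fin (d + 1) → ℤ := fun j => ⌊e.repr (u * p) j⌋ with hn₁
  set s : Φ := ∑ j, n₁ j • e j with hs
  set y : Φ := s - u * p with hy
  have hyrepr : ∀ j, |((e.repr y j : ℚ) : ℝ)| ≤ 1 := by
    intro j
    rw [hy, map_sub, Finsupp.sub_apply, hs, repr_sum_smul, hn₁]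
    have h1 := Int.floor_le (e.repr (u * p) j)
    have h2 := Int.lt_floor_add_one (e.repr (u * p) j)
    have h3 : |((⌊e.repr (u * p) j⌋ : ℤ) : ℚ) - e.repr (u * p) j| ≤ 1 := by
      rw [abs_le]
      constructor <;> linarith
    exact_mod_cast h3
  have hynorm := hc y 1 hyrepr
  rw [mul_one] at hynorm
  have hyabs : |(y : ℝ)| ≤ c := by
    rw [← IntermediateField.norm_realEmbedding]
    exact hynorm _
  obtain ⟨n, hn⟩ := exists_eq_sum_smul (U.inv_mul_mem τ s (sum_smul_mem e n₁))
  have hval : integerCombination ω n = (u : ℝ)⁻¹ * (s : ℝ) := by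
    rw [← coe_sum_smul he, ← hn]
    push_cast
    rfl
  have hsval : (s : ℝ) = (u : ℝ) * (p : ℝ) + (y : ℝ) := by
    have : s = u * p + y := by rw [hy]; ring
    rw [this]
    push_cast
    rfl
  have hup1 : c < (u : ℝ) * (p : ℝ) := by
    rw [mul_comm, ← div_lt_iff₀ hu0]
    linarith
  have hup2 : (u : ℝ) * (p : ℝ) < 2 * c := by
    rw [mul_comm, ← lt_div_iff₀ hu0]
    linarith
  rw [abs_le] at hyabs
  refine ⟨n, ?_, ?_, ?_⟩
  · rw [hval]
    have : 0 < (s : ℝ) := by linarith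
    positivity
  · rw [hval]
    have h1 := U.inv_norm_le_pow τ (by linarith)
    rw [IntermediateField.norm_realEmbedding, abs_of_pos hu0] at h1
    calc (u : ℝ)⁻¹ * (s : ℝ) ≤ (U.bound / τ ^ d) * (3 * c) := by
          apply mul_le_mul h1 (by linarith) (by linarith) (by positivity)
      _ = 3 * c * (U.bound * q ^ d) / t ^ d := by
          rw [hτ, div_pow]
          field_simp
  · have hdiff : (∑ j, n j • e j) - p = u⁻¹ * y := by
      rw [← hn, hy, mul_sub, inv_mul_cancel_left₀ hune]
    have hbd : ∀ σ : Φ →+* ℂ, ‖σ (u⁻¹ * y)‖ ≤ U.bound * τ * c := by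
      intro σ
      rw [map_mul, norm_mul]
      exact mul_le_mul (U.inv_norm_le_all hτ1 σ) (hynorm σ) (norm_nonneg _) (by positivity)
    have hco := hA _ _ hbd
    have hsmall : A * (U.bound * τ * c) ≤ ρ / 2 * t := by
      have h1 : 2 * (A * (U.bound * c)) ≤ q * ρ := by
        have : 2 * (A * (U.bound * c)) / ρ ≤ q := by linarith
        rwa [div_le_iff₀ hρ] at this
      have h2 : t = τ * q := by rw [hτ]; field_simp
      rw [h2]
      nlinarith
    rw [pi_norm_le_iff_of_nonneg (by positivity)]
    intro k
    have h1 := hco k.succ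
    rw [← hdiff, map_sub, Finsupp.sub_apply, repr_sum_smul, hprepr, Fin.cons_succ] at h1
    push_cast at h1
    have h2 := (hr k).le
    rw [Pi.sub_apply, Real.norm_eq_abs]
    have h3 : (n k.succ : ℝ) - z k = ((n k.succ : ℝ) - r k) + (r k - z k) := by ring
    rw [h3]
    refine (abs_add_le _ _).trans ?_
    rw [abs_sub_comm] at h2
    linarith

/-- Aim at half the vector from x to the centre tp. Then x plus the displacement is the midpoint of
x and a point within ρ t of tp, hence lies in tR by convexity. -/
theorem UnitFlow.exists_successor (U : UnitFlow Φ.realEmbedding e d)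
    (he : ∀ j, (e j : ℝ) = (Fin.cons 1 ω : Fin (d + 1) → ℝ) j)
    {R : Set (Fin d → ℝ)} (hR : Convex ℝ R) (hint : (interior R).Nonempty) :
    ∃ B T : ℝ, 0 ≤ B ∧ 1 ≤ T ∧ ∀ t, T ≤ t → ∀ x ∈ t • R, ∃ n : Fin (d + 1) → ℤ,
      0 < integerCombination ω n ∧ integerCombination ω n ≤ B / t ^ d ∧
      x + (fun k : Fin d => (n k.succ : ℝ)) ∈ t • R := by
  obtain ⟨p, hp⟩ := hint
  obtain ⟨ρ, hρ, hpR⟩ := Metric.nhds_basis_closedBall.mem_iff.1 (mem_interior_iff_mem_nhds.1 hp)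
  obtain ⟨B, T, hB, hT, h⟩ := U.exists_small_integerCombination he (half_pos hρ)
  refine ⟨B, T, hB, hT, fun t ht x hx => ?_⟩
  have ht0 : 0 < t := by linarith
  obtain ⟨x', hx', rfl⟩ := hx
  obtain ⟨n, hn0, hnB, hn⟩ := h t ht ((1 / 2 : ℝ) • (t • p - t • x'))
  refine ⟨n, hn0, hnB, ?_⟩
  set δ := (fun k : Fin d => (n k.succ : ℝ)) - (1 / 2 : ℝ) • (t • p - t • x') with hδ
  have hmem : p + (2 * t⁻¹) • δ ∈ R := by
    apply hpR
    rw [mem_closedBall_iff_norm, add_sub_cancel_left, norm_smul,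
      Real.norm_of_nonneg (by positivity)]
    calc 2 * t⁻¹ * ‖δ‖ ≤ 2 * t⁻¹ * (ρ / 2 * t) := by gcongr
      _ = ρ := by field_simp
  refine ⟨_, hR hx' hmem (by norm_num : (0 : ℝ) ≤ 1 / 2) (by norm_num : (0 : ℝ) ≤ 1 / 2)
    (by norm_num), ?_⟩
  have hn' : (fun k : Fin d => (n k.succ : ℝ)) = δ + (1 / 2 : ℝ) • (t • p - t • x') := by
    rw [hδ, sub_add_cancel]
  simp only [hn']
  ext k
  simp only [Pi.add_apply, Pi.smul_apply, smul_eq_mul, Pi.sub_apply]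
  field_simp
  ring

/-- If the successor step passes 1, the gap is still at most that step because it ends below 1. For
t below the threshold T, a gap is less than 1 ≤ T^d / t^d. -/
theorem UnitFlow.exists_spacing_le (U : UnitFlow Φ.realEmbedding e d)
    (he : ∀ j, (e j : ℝ) = (Fin.cons 1 ω : Fin (d + 1) → ℝ) j)
    {R : Set (Fin d → ℝ)} (hR : Convex ℝ R) (hb : Bornology.IsBounded R)
    (hint : (interior R).Nonempty) :
    ∃ B : ℝ, 0 ≤ B ∧ ∀ t, 1 < t → ∀ i, spacing ω hb t i ≤ B / t ^ d := by
  obtain ⟨B, T, hB, hT, h⟩ := U.exists_successor he hR hint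
  refine ⟨B + T ^ d, by positivity, fun t ht i => ?_⟩
  have ht0 : 0 < t := by linarith
  rcases le_or_gt T t with hTt | hTt
  · have hmono : B / t ^ d ≤ (B + T ^ d) / t ^ d := by
      gcongr
      have : 0 ≤ T ^ d := by positivity
      linarith
    refine le_trans ?_ hmono
    obtain ⟨n, hn0, hnB, hn⟩ := h t hTt _ (orderedLatticePoint_mem (ω := ω) hb t ⟨i, by omega⟩)
    refine le_trans ?_ hnB
    have hy0 := (orderedPoint_mem_Ico (ω := ω) hb t ⟨i, by omega⟩).1
    have hy1 := (orderedPoint_mem_Ico (ω := ω) hb t ⟨i + 1, by omega⟩).2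
    have hsp : spacing ω hb t i = orderedPoint ω hb t ⟨i + 1, by omega⟩ -
      orderedPoint ω hb t ⟨i, by omega⟩ := rfl
    rcases lt_or_ge (orderedPoint ω hb t ⟨i, by omega⟩ + integerCombination ω n) 1 with h1 | h1
    · have := spacing_le_sub hb t i (mem_fracPoints_of_add hb (n := n)
        (mem_latticePoints_add_iff.2 hn) (by linarith) h1) (by linarith)
      linarith
    · linarith
  · refine (spacing_lt_one hb t i).le.trans ?_
    rw [one_le_div (by positivity)]
    have : t ^ d ≤ T ^ d := by gcongr
    linarith

/-- At the given real embedding a factor O(t^d) meets a gap O(t^(-d)); at the others O(1/t) meets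
O(t). All embeddings of the product are bounded, hence so are its integer coordinates. -/
theorem UnitFlow.exists_bounded_coefficients (U : UnitFlow Φ.realEmbedding e d)
    (he : ∀ j, (e j : ℝ) = (Fin.cons 1 ω : Fin (d + 1) → ℝ) j)
    {R : Set (Fin d → ℝ)} (hR : Convex ℝ R) (hb : Bornology.IsBounded R)
    (hint : (interior R).Nonempty) :
    ∃ B : ℕ, ∀ t, 1 < t → ∀ i, ∃ n : Fin (d + 1) → ℤ, (∀ j, |n j| ≤ B) ∧
      (((U.unit t : 𝓞 Φ) : Φ) : ℝ) * spacing ω hb t i = integerCombination ω n := by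
  obtain ⟨B, hB0, hB⟩ := U.exists_spacing_le he hR hb hint
  obtain ⟨c, hc1, hc⟩ := exists_norm_embedding_le e
  obtain ⟨A, hA0, hA⟩ := exists_abs_repr_le e
  obtain ⟨D, hD0, hD⟩ := hb.exists_pos_norm_le
  have hbd := U.one_le_bound
  set D' := 2 * D + (1 + ∑ k, 2 * D * |ω k|) with hD'
  have hS : 0 ≤ ∑ k, 2 * D * |ω k| := Finset.sum_nonneg fun k _ => by positivity
  have hD'0 : 0 ≤ D' := by positivity
  refine ⟨⌈A * (U.bound * (c * D') + U.bound * B)⌉₊, fun t ht i => ?_⟩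
  have ht0 : 0 < t := by linarith
  obtain ⟨m, hm, hadd⟩ := exists_spacing_eq (ω := ω) hb t i
  have hnorm : ∀ a ∈ latticePoints R t, ∀ k, |(a k : ℝ)| ≤ D * t := by
    rintro a ⟨a', ha', haa⟩ k
    have h1 : (a k : ℝ) = t * a' k := (congrFun haa k).symm
    rw [h1, abs_mul, abs_of_pos ht0, mul_comm]
    gcongr
    exact (norm_le_pi_norm a' k).trans (hD a' ha')
  have hmk : ∀ k : Fin d, |(m k.succ : ℝ)| ≤ 2 * D * t := by
    intro k
    have h1 := hnorm _ (orderedLatticePoint_mem (ω := ω) hb t ⟨i, by omega⟩) k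
    have h2 := hnorm _ (orderedLatticePoint_mem (ω := ω) hb t ⟨i + 1, by omega⟩) k
    have h3 : (m k.succ : ℝ) = (orderedLatticePoint ω hb t ⟨i + 1, by omega⟩ k : ℝ) -
        (orderedLatticePoint ω hb t ⟨i, by omega⟩ k : ℝ) := by
      rw [← hadd, Pi.add_apply]
      push_cast
      ring
    rw [h3]
    refine (abs_sub _ _).trans ?_
    linarith
  have hm0 : |(m 0 : ℝ)| ≤ (1 + ∑ k, 2 * D * |ω k|) * t := by
    have h1 : (m 0 : ℝ) = spacing ω hb t i - ∑ k : Fin d, (m k.succ : ℝ) * ω k := by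
      rw [hm, integerCombination]
      ring
    have h2 := spacing_pos (ω := ω) hb t i
    have h3 := spacing_lt_one (ω := ω) hb t i
    have h4 : |∑ k : Fin d, (m k.succ : ℝ) * ω k| ≤ (∑ k, 2 * D * |ω k|) * t := by
      refine (Finset.abs_sum_le_sum_abs _ _).trans ?_
      rw [Finset.sum_mul]
      refine Finset.sum_le_sum fun k _ => ?_
      rw [abs_mul]
      nlinarith [hmk k, abs_nonneg (ω k)]
    rw [h1]
    refine (abs_sub _ _).trans ?_
    rw [abs_of_pos h2]
    nlinarith
  have hmj : ∀ j, |(m j : ℝ)| ≤ D' * t := by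
    intro j
    refine Fin.cases ?_ (fun k => ?_) j
    · refine hm0.trans ?_
      gcongr
      rw [hD']
      linarith
    · refine (hmk k).trans ?_
      gcongr
      rw [hD']
      linarith
  set u : Φ := ((U.unit t : 𝓞 Φ) : Φ) with hu
  have hu0 : (0 : ℝ) < (u : ℝ) := U.unit_pos t
  set η : Φ := ∑ j, m j • e j with hη
  have hηval : (η : ℝ) = spacing ω hb t i := by rw [hη, coe_sum_smul he, hm]
  have hησ := hc η (D' * t) (fun j => by
    rw [hη, repr_sum_smul]
    exact_mod_cast hmj j)
  obtain ⟨n, hn⟩ := exists_eq_sum_smul (U.unit_mul_mem t η (sum_smul_mem e m))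
  have huη : ∀ σ : Φ →+* ℂ, ‖σ (u * η)‖ ≤ U.bound * (c * D') + U.bound * B := by
    intro σ
    have hp1 : 0 ≤ U.bound * (c * D') := by positivity
    have hp2 : 0 ≤ U.bound * B := by positivity
    rw [map_mul, norm_mul]
    by_cases hσ : σ = Φ.realEmbedding
    · rw [hσ]
      have h1 := U.norm_le_pow t ht0
      have h2 : ‖Φ.realEmbedding η‖ ≤ B / t ^ d := by
        rw [IntermediateField.norm_realEmbedding, hηval, abs_of_pos (spacing_pos hb t i)]
        exact hB t ht i
      calc _ ≤ (U.bound * t ^ d) * (B / t ^ d) :=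
            mul_le_mul h1 h2 (norm_nonneg _) (by positivity)
        _ = U.bound * B := by field_simp
        _ ≤ _ := by linarith
    · calc _ ≤ (U.bound / t) * (c * (D' * t)) :=
            mul_le_mul (U.norm_le t ht0 σ hσ) (hησ σ) (norm_nonneg _) (by positivity)
        _ = U.bound * (c * D') := by field_simp
        _ ≤ _ := by linarith
  refine ⟨n, fun j => ?_, ?_⟩
  · have h1 := hA _ _ huη j
    have h2 : u * η = ∑ j, n j • e j := hn
    rw [h2, repr_sum_smul] at h1
    have h3 := h1.trans (Nat.le_ceil _)
    exact_mod_cast h3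
  · rw [← hηval, ← coe_sum_smul he, ← hn]
    push_cast
    rfl

/-- The labels: finitely many positive integer combinations of `1, ω₁, …, ω_d` containing all
rescaled spacings. -/
theorem UnitFlow.exists_labels (U : UnitFlow Φ.realEmbedding e d)
    (he : ∀ j, (e j : ℝ) = (Fin.cons 1 ω : Fin (d + 1) → ℝ) j)
    {R : Set (Fin d → ℝ)} (hR : Convex ℝ R) (hb : Bornology.IsBounded R)
    (hint : (interior R).Nonempty) :
    ∃ (N : ℕ) (n : Fin (N + 1) → Fin (d + 1) → ℤ),
      StrictMono (fun j => integerCombination ω (n j)) ∧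
      (∀ j, 0 < integerCombination ω (n j)) ∧
      ∀ t, 1 < t → ∀ i, ∃ j, (((U.unit t : 𝓞 Φ) : Φ) : ℝ) * spacing ω hb t i =
        integerCombination ω (n j) := by
  classical
  obtain ⟨B, hB⟩ := U.exists_bounded_coefficients he hR hb hint
  -- The label 1 is added only to make the set nonempty, so that it can be indexed by `Fin (N + 1)`.
  set S : Finset ℝ := insert 1 (((Finset.Icc (fun _ : Fin (d + 1) => -(B : ℤ))
    fun _ => (B : ℤ)).image (integerCombination ω)).filter (0 < ·)) with hS
  have hS0 : S.card ≠ 0 := by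
    rw [Finset.card_ne_zero]
    exact ⟨1, Finset.mem_insert_self _ _⟩
  obtain ⟨N, hN⟩ := Nat.exists_eq_succ_of_ne_zero hS0
  have hmem : ∀ x ∈ S, 0 < x ∧ ∃ n, x = integerCombination ω n := by
    intro x hx
    rcases Finset.mem_insert.1 hx with rfl | hx
    · exact ⟨one_pos, Fin.cons 1 0, by simp [integerCombination]⟩
    · obtain ⟨h1, h2⟩ := Finset.mem_filter.1 hx
      obtain ⟨n, -, hn⟩ := Finset.mem_image.1 h1
      exact ⟨h2, n, hn.symm⟩
  choose n hn using fun j => (hmem _ (S.orderEmbOfFin_mem hN j)).2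
  refine ⟨N, n, ?_, fun j => ?_, fun t ht i => ?_⟩
  · simp only [← hn]
    exact (S.orderEmbOfFin hN).strictMono
  · rw [← hn]
    exact (hmem _ (S.orderEmbOfFin_mem hN j)).1
  · obtain ⟨m, hmB, hm⟩ := hB t ht i
    have hx : integerCombination ω m ∈ S := by
      refine Finset.mem_insert_of_mem (Finset.mem_filter.2 ⟨Finset.mem_image.2 ⟨m, ?_, rfl⟩, ?_⟩)
      · rw [Finset.mem_Icc]
        exact ⟨fun j => (abs_le.1 (hmB j)).1, fun j => (abs_le.1 (hmB j)).2⟩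
      · rw [← hm]
        exact mul_pos (U.unit_pos t) (spacing_pos hb t i)
    have : integerCombination ω m ∈ Set.range (S.orderEmbOfFin hN) := by
      rw [Finset.range_orderEmbOfFin]
      exact hx
    obtain ⟨j, hj⟩ := this
    exact ⟨j, by rw [hm, ← hn, hj]⟩

end Labels

section QuasiperiodicFrequencies

open MeasureTheory

/-! ### Lipschitz dependence on the quasiperiodic parameters -/

theorem norm_toCircle_sub_le (x y : UnitAddCircle) :
    ‖(AddCircle.toCircle x : ℂ) - AddCircle.toCircle y‖ ≤ 2 * Real.pi * dist x y := by
  obtain ⟨r, hr⟩ := QuotientAddGroup.mk_surjective (x - y)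
  have hr' : ((r - round r : ℝ) : UnitAddCircle) = x - y := by
    have h1 : ((round r : ℝ) : UnitAddCircle) = 0 := by
      rw [AddCircle.coe_eq_zero_iff]
      exact ⟨round r, by simp⟩
    rw [AddCircle.coe_sub, h1, sub_zero]
    exact hr
  have hd : dist x y = |r - round r| := by
    rw [dist_eq_norm, ← hr]
    exact UnitAddCircle.norm_eq
  have hx : x = y + ((r - round r : ℝ) : UnitAddCircle) := by rw [hr']; abel
  have hmul : (AddCircle.toCircle x : ℂ) - AddCircle.toCircle y =
      AddCircle.toCircle y *
        (Complex.exp (Complex.I * ((2 * Real.pi * (r - round r) : ℝ) : ℂ)) - 1) := by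
    rw [hx, AddCircle.toCircle_add, Circle.coe_mul, toCircle_coe_unitAddCircle, mul_sub, mul_one]
    congr 3
    push_cast
    ring
  rw [hmul, norm_mul, Circle.norm_coe, one_mul, hd]
  refine (Real.norm_exp_I_mul_ofReal_sub_one_le).trans ?_
  rw [Real.norm_eq_abs, abs_mul, abs_of_pos Real.two_pi_pos]

theorem norm_cexp_sub_cexp_le {S : ℝ} {z w : ℂ} (hz : ‖z‖ ≤ S) (hw : ‖w‖ ≤ S) :
    ‖Complex.exp z - Complex.exp w‖ ≤ Real.exp S * ‖z - w‖ := by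
  refine (convex_closedBall (0 : ℂ) S).norm_image_sub_le_of_norm_deriv_le
    (fun x _ => Complex.differentiableAt_exp) (fun x hx => ?_) (by simpa using hw)
    (by simpa using hz)
  rw [Complex.deriv_exp, Complex.norm_exp]
  apply Real.exp_le_exp.2
  exact (Complex.re_le_norm x).trans (by simpa using hx)

theorem norm_sum_unitInterval_mul_le {κ : Type*} [Fintype κ] (x : κ → unitInterval) (l : κ → ℂ) :
    ‖∑ b, ((x b : ℝ) : ℂ) * l b‖ ≤ ∑ b, ‖l b‖ := by
  refine norm_sum_le_of_le _ fun b _ => ?_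
  rw [norm_mul, Complex.norm_real, Real.norm_of_nonneg (x b).2.1]
  exact mul_le_of_le_one_left (norm_nonneg _) (x b).2.2

theorem norm_sum_unitInterval_mul_sub_le {κ : Type*} [Fintype κ] (x y : κ → unitInterval)
    (l : κ → ℂ) :
    ‖∑ b, ((x b : ℝ) : ℂ) * l b - ∑ b, ((y b : ℝ) : ℂ) * l b‖ ≤ (∑ b, ‖l b‖) * dist x y := by
  rw [← Finset.sum_sub_distrib, Finset.sum_mul]
  refine norm_sum_le_of_le _ fun b _ => ?_
  rw [← sub_mul, norm_mul, mul_comm]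
  gcongr
  rw [← Complex.ofReal_sub, Complex.norm_real]
  exact dist_le_pi_dist x y b

/-- The real part of a linear combination of characters of a torus with amplitudes depending
exponentially on further parameters. -/
noncomputable def characterSum {k r : ℕ} (a : Fin k → ℂ) (l : Fin k → Fin r → ℂ)
    (p : (Fin k → UnitAddCircle) × (Fin r → unitInterval)) : ℝ :=
  (∑ σ, a σ * (AddCircle.toCircle (p.1 σ) *
    Complex.exp (∑ b, ((p.2 b : ℝ) : ℂ) * l σ b))).re

theorem characterSum_lipschitz {k r : ℕ} (a : Fin k → ℂ) (l : Fin k → Fin r → ℂ) :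
    ∃ K : ℝ, 0 ≤ K ∧ ∀ p q, |characterSum a l p - characterSum a l q| ≤ K * dist p q := by
  refine ⟨∑ σ, ‖a σ‖ * (Real.exp (∑ b, ‖l σ b‖) * (∑ b, ‖l σ b‖ + 2 * Real.pi)),
    Finset.sum_nonneg fun σ _ => ?_, fun p q => ?_⟩
  · have : 0 ≤ ∑ b, ‖l σ b‖ := Finset.sum_nonneg fun b _ => norm_nonneg _
    positivity
  · unfold characterSum
    rw [← Complex.sub_re, ← Finset.sum_sub_distrib, Finset.sum_mul]
    refine (Complex.abs_re_le_norm _).trans (norm_sum_le_of_le _ fun σ _ => ?_)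
    rw [← mul_sub, norm_mul, mul_assoc]
    gcongr
    set S := ∑ b, ‖l σ b‖ with hS
    have hS0 : 0 ≤ S := Finset.sum_nonneg fun b _ => norm_nonneg _
    set z := ∑ b, ((p.2 b : ℝ) : ℂ) * l σ b
    set w := ∑ b, ((q.2 b : ℝ) : ℂ) * l σ b
    have hz : ‖z‖ ≤ S := norm_sum_unitInterval_mul_le _ _
    have hw : ‖w‖ ≤ S := norm_sum_unitInterval_mul_le _ _
    have e1 : ‖Complex.exp z - Complex.exp w‖ ≤ Real.exp S * (S * dist p q) := by
      refine (norm_cexp_sub_cexp_le hz hw).trans ?_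
      gcongr
      refine (norm_sum_unitInterval_mul_sub_le _ _ _).trans ?_
      gcongr
      exact le_max_right _ _
    have e2 : ‖(AddCircle.toCircle (p.1 σ) : ℂ) - AddCircle.toCircle (q.1 σ)‖ ≤
        2 * Real.pi * dist p q := by
      refine (norm_toCircle_sub_le _ _).trans ?_
      gcongr
      exact (dist_le_pi_dist p.1 q.1 σ).trans (le_max_left _ _)
    have e3 : ‖Complex.exp w‖ ≤ Real.exp S := by
      rw [Complex.norm_exp]
      exact Real.exp_le_exp.2 ((Complex.re_le_norm w).trans hw)
    have hsplit : (AddCircle.toCircle (p.1 σ) : ℂ) * Complex.exp z -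
        AddCircle.toCircle (q.1 σ) * Complex.exp w =
        AddCircle.toCircle (p.1 σ) * (Complex.exp z - Complex.exp w) +
        ((AddCircle.toCircle (p.1 σ) : ℂ) - AddCircle.toCircle (q.1 σ)) * Complex.exp w := by
      ring
    rw [hsplit]
    refine (norm_add_le _ _).trans ?_
    rw [norm_mul, norm_mul, Circle.norm_coe, one_mul]
    have := mul_le_mul e2 e3 (norm_nonneg _) (by positivity)
    linarith

/-! ### Relative volumes of the cells -/

theorem exists_returnCell_frequency {d : ℕ} (N : ℕ) {R : Set (Fin d → ℝ)} (hR : Convex ℝ R)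
    (hb : Bornology.IsBounded R) (hint : (interior R).Nonempty) :
    ∃ (G : (Fin (N + 1) → Fin d → ℝ) → stdSimplex ℝ (Fin (N + 1))) (K : ℝ), 0 ≤ K ∧
      (∀ v j, (G v : Fin (N + 1) → ℝ) j = volume.real (returnCell R v j) / volume.real R) ∧
      ∀ v v', dist (G v) (G v') ≤ K * ‖v - v'‖ := by
  have hV := volume_real_pos_of_interior hb hint
  obtain ⟨K, hK, hlip⟩ := volume_returnCell_lipschitz N hR hb hint
  refine ⟨fun v => ⟨fun j => volume.real (returnCell R v j) / volume.real R, fun j => by positivity,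
    ?_⟩, K / volume.real R, by positivity, fun v j => rfl, fun v v' => ?_⟩
  · rw [← Finset.sum_div, sum_volume_returnCell hR hb, div_self hV.ne']
  · rw [Subtype.dist_eq, dist_pi_le_iff (by positivity)]
    intro j
    rw [Real.dist_eq, ← sub_div, abs_div, abs_of_pos hV, div_mul_eq_mul_div]
    gcongr
    exact hlip v v' j

/-! ### Quasiperiodicity of the rescaled displacements -/

section Main

open NumberField NumberField.Units

variable {d : ℕ} {ω : Fin d → ℝ} {Φ : IntermediateField ℚ ℝ} [NumberField Φ]
  {e : Module.Basis (Fin (d + 1)) ℚ Φ}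

/-- Up to `O(1/t)`, the rescaled coordinates of a fixed element divided by the unit `u(t)` are
quasiperiodic. -/
theorem UnitFlow.repr_inv_mul_approx (U : UnitFlow Φ.realEmbedding e d)
    (ψ : Fin (d + 1) ≃ (Φ →+* ℂ)) (x : Φ) (i : Fin (d + 1)) :
    ∃ (a : Fin (d + 1) → ℂ) (C : ℝ), 0 ≤ C ∧ ∀ t : ℝ, 1 < t →
      |t⁻¹ * ((e.repr (((U.unit t : 𝓞 Φ) : Φ)⁻¹ * x) i : ℚ) : ℝ) -
        characterSum a (fun σ => U.logarithm (ψ σ))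
          (fun σ => ((U.frequency (ψ σ) * Real.log t : ℝ) : UnitAddCircle),
            fun b => fracUnit (U.exponent b * Real.log t))| ≤ C / t := by
  classical
  obtain ⟨κ, hκ⟩ := exists_repr_eq_sum_embeddings e
  have hbd := U.one_le_bound
  -- The real embedding gets amplitude zero: its term, divided by u(t), goes into the error. Keeping
  -- its index lets the torus have one coordinate per embedding.
  refine ⟨fun σ => if ψ σ = Φ.realEmbedding then 0 else κ i (ψ σ) * ψ σ x,
    ‖κ i Φ.realEmbedding * Φ.realEmbedding x‖ * U.bound, by positivity, fun t ht => ?_⟩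
  have ht0 : 0 < t := by linarith
  set u : Φ := ((U.unit t : 𝓞 Φ) : Φ) with hu
  have h1 : ((t⁻¹ * ((e.repr (u⁻¹ * x) i : ℚ) : ℝ) : ℝ) : ℂ) =
      ∑ σ, κ i (ψ σ) * ψ σ x * ((t : ℂ)⁻¹ * (ψ σ u)⁻¹) := by
    push_cast
    rw [hκ, ← ψ.sum_comp, Finset.mul_sum]
    refine Finset.sum_congr rfl fun σ _ => ?_
    rw [map_mul, map_inv₀]
    ring
  have h2 : ∀ σ, κ i (ψ σ) * ψ σ x * ((t : ℂ)⁻¹ * (ψ σ u)⁻¹) =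
      (if ψ σ = Φ.realEmbedding then 0 else κ i (ψ σ) * ψ σ x) *
        (AddCircle.toCircle ((U.frequency (ψ σ) * Real.log t : ℝ) : UnitAddCircle) *
          Complex.exp (∑ b, ((fracUnit (U.exponent b * Real.log t) : ℝ) : ℂ) *
            U.logarithm (ψ σ) b)) +
      (if ψ σ = Φ.realEmbedding then
        κ i Φ.realEmbedding * Φ.realEmbedding x * ((t : ℂ)⁻¹ * (Φ.realEmbedding u)⁻¹) else 0) := by
    intro σ
    split_ifs with h
    · rw [h, zero_mul, zero_add]
    · rw [add_zero, U.inv_eq t ht0 (ψ σ) h]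
  have h3 : ((t⁻¹ * ((e.repr (u⁻¹ * x) i : ℚ) : ℝ) : ℝ) : ℂ).re =
      t⁻¹ * ((e.repr (u⁻¹ * x) i : ℚ) : ℝ) := Complex.ofReal_re _
  rw [← h3, h1, Finset.sum_congr rfl fun σ _ => h2 σ, Finset.sum_add_distrib, Complex.add_re]
  unfold characterSum
  rw [add_sub_cancel_left]
  refine (Complex.abs_re_le_norm _).trans ?_
  have h4 : ∑ σ, (if ψ σ = Φ.realEmbedding then
      κ i Φ.realEmbedding * Φ.realEmbedding x * ((t : ℂ)⁻¹ * (Φ.realEmbedding u)⁻¹) else 0) =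
      κ i Φ.realEmbedding * Φ.realEmbedding x * ((t : ℂ)⁻¹ * (Φ.realEmbedding u)⁻¹) := by
    rw [ψ.sum_comp (fun σ => if σ = Φ.realEmbedding then
      κ i Φ.realEmbedding * Φ.realEmbedding x * ((t : ℂ)⁻¹ * (Φ.realEmbedding u)⁻¹) else 0)]
    simp
  rw [h4, norm_mul, norm_mul (t : ℂ)⁻¹, norm_inv, norm_inv, Complex.norm_real,
    Real.norm_of_nonneg ht0.le, mul_div_assoc]
  gcongr
  rw [inv_mul_eq_div]
  gcongr
  exact (U.inv_norm_le_pow t ht0).trans (div_le_self (by linarith) (one_le_pow₀ ht.le))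

end Main

end QuasiperiodicFrequencies

/-! ### Assembly of the main theorem -/

theorem theoremA {d : ℕ} (hd : 1 ≤ d) (ω : Fin d → ℝ)
    (Φ : IntermediateField ℚ ℝ) [NumberField Φ]
    (hind : LinearIndependent ℚ (Fin.cons 1 ω : Fin (d + 1) → ℝ))
    (hspan : Submodule.span ℚ (Set.range (Fin.cons 1 ω : Fin (d + 1) → ℝ)) =
      Subalgebra.toSubmodule Φ.toSubalgebra)
    (R : Set (Fin d → ℝ)) (hconv : Convex ℝ R) (hbdd : Bornology.IsBounded R)
    (hint : (interior R).Nonempty) :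
    ∃ (J : ℕ) (s : Fin J → Φ) (u : ℝ → (NumberField.RingOfIntegers Φ)ˣ),
      StrictMono (fun j => (s j : ℝ)) ∧
      -- uniform labeling
      (∀ t : ℝ, 1 < t → ∀ i : Fin ((fracPoints ω hbdd t).card - 1),
        ∃ j : Fin J,
          (((u t : NumberField.RingOfIntegers Φ) : Φ) : ℝ) * spacing ω hbdd t i = (s j : ℝ)) ∧
      -- quasiperiodicity
      (∃ (k : ℕ)
        (g : (Fin k → UnitAddCircle) × (Fin (NumberField.Units.rank Φ) → unitInterval) →
          stdSimplex ℝ (Fin J))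
        (θ : Fin k → ℝ) (β : Fin (NumberField.Units.rank Φ) → ℝ) (α : ℝ),
        k ≤ d + 1 ∧ (∃ K : NNReal, LipschitzWith K g) ∧ 0 < α ∧ α < 1 ∧
        ∃ C : ℝ, ∀ t : ℝ, 1 < t → 2 ≤ (fracPoints ω hbdd t).card → ∀ j : Fin J,
          |spacingProportion ω hbdd t (((u t : NumberField.RingOfIntegers Φ) : Φ) : ℝ) (s j : ℝ)
            - (g (fun a => ((θ a * Real.log t : ℝ) : UnitAddCircle),
                fun b => fracUnit (β b * Real.log t)) : Fin J → ℝ) j|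
            ≤ C * α ^ Real.log t) := by
  classical
  obtain ⟨e, he⟩ := exists_basis_coe_eq hind hspan
  have hfin : Module.finrank ℚ Φ = d + 1 := by
    rw [Module.finrank_eq_card_basis e, Fintype.card_fin]
  obtain ⟨U⟩ := nonempty_unitFlow (IntermediateField.isReal_realEmbedding (Φ := Φ)) e hfin
  obtain ⟨N, ν, hmono, hpos, hlab⟩ := U.exists_labels he hconv hbdd hint
  obtain ⟨G, KG, hKG, hG, hGlip⟩ := exists_returnCell_frequency N hconv hbdd hint
  obtain ⟨C₁, hC₁, hfreq⟩ := returnCell_frequency_approx hd N hconv hbdd hint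
  set ψ : Fin (d + 1) ≃ (Φ →+* ℂ) := (Fintype.equivFinOfCardEq (by
    rw [NumberField.Embeddings.card, hfin])).symm
  choose a C₂ hC₂ happrox using fun (j : Fin (N + 1)) (k : Fin d) =>
    U.repr_inv_mul_approx ψ (∑ i, ν j i • e i) k.succ
  choose K hK hKlip using fun (j : Fin (N + 1)) (k : Fin d) =>
    characterSum_lipschitz (a j k) (fun σ => U.logarithm (ψ σ))
  set V : (Fin (d + 1) → UnitAddCircle) × (Fin (NumberField.Units.rank Φ) → unitInterval) →
      Fin (N + 1) → Fin d → ℝ :=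
    fun p j k => characterSum (a j k) (fun σ => U.logarithm (ψ σ)) p with hVdef
  have hle : ∀ f : Fin (N + 1) → Fin d → ℝ, (∀ j k, 0 ≤ f j k) → ∀ j k,
      f j k ≤ ∑ j, ∑ k, f j k := fun f hf j k =>
    (Finset.single_le_sum (fun k _ => hf j k) (Finset.mem_univ k)).trans
      (Finset.single_le_sum (f := fun j => ∑ k, f j k)
        (fun j _ => Finset.sum_nonneg fun k _ => hf j k) (Finset.mem_univ j))
  have hsum0 : ∀ f : Fin (N + 1) → Fin d → ℝ, (∀ j k, 0 ≤ f j k) → 0 ≤ ∑ j, ∑ k, f j k :=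
    fun f hf => Finset.sum_nonneg fun j _ => Finset.sum_nonneg fun k _ => hf j k
  have hVlip : ∀ p q, ‖V p - V q‖ ≤ (∑ j, ∑ k, K j k) * dist p q := by
    intro p q
    have h0 := hsum0 K hK
    rw [pi_norm_le_iff_of_nonneg (by positivity)]
    intro j
    rw [pi_norm_le_iff_of_nonneg (by positivity)]
    intro k
    refine (hKlip j k p q).trans ?_
    gcongr
    exact hle K hK j k
  -- All errors are O(1/t), and α = e⁻¹ turns α ^ log t into 1/t.
  refine ⟨N + 1, fun j => ∑ i, ν j i • e i, U.unit, ?_, ?_, d + 1, fun p => G (V p),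
    fun σ => U.frequency (ψ σ), U.exponent, Real.exp (-1), le_rfl, ?_, Real.exp_pos _,
    by rw [Real.exp_lt_one_iff]; norm_num, C₁ + KG * ∑ j, ∑ k, C₂ j k, ?_⟩
  · simp only [coe_sum_smul he]
    exact hmono
  · simp only [coe_sum_smul he]
    exact hlab
  · refine ⟨(KG * ∑ j, ∑ k, K j k).toNNReal, LipschitzWith.of_dist_le_mul fun p q => ?_⟩
    refine (hGlip _ _).trans ?_
    rw [Real.coe_toNNReal _ (mul_nonneg hKG (hsum0 K hK)), mul_assoc]
    gcongr
    exact hVlip p q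
  · intro t ht _ j
    have ht0 : 0 < t := by linarith
    have hα : Real.exp (-1) ^ Real.log t = 1 / t := by
      rw [← Real.exp_mul, neg_one_mul, Real.exp_neg, Real.exp_log ht0, one_div]
    rw [hα, coe_sum_smul he]
    set u : Φ := ((U.unit t : NumberField.RingOfIntegers Φ) : Φ) with hu
    have hu0 : (0 : ℝ) < (u : ℝ) := U.unit_pos t
    have hune : u ≠ 0 := by
      intro h
      rw [h] at hu0
      exact lt_irrefl _ hu0
    have hcoef : ∀ j, ∃ n : Fin (d + 1) → ℤ, u⁻¹ * ∑ i, ν j i • e i = ∑ i, n i • e i := fun j =>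
      exists_eq_sum_smul (U.inv_mul_mem t _ (sum_smul_mem e (ν j)))
    choose n hn using hcoef
    have hsn : ∀ j, integerCombination ω (ν j) = (u : ℝ) * integerCombination ω (n j) := by
      intro j
      rw [← coe_sum_smul he, ← coe_sum_smul he, ← hn]
      have : ∑ i, ν j i • e i = u * (u⁻¹ * ∑ i, ν j i • e i) := by
        rw [mul_inv_cancel_left₀ hune]
      conv_lhs => rw [this]
      rfl
    set M := (latticePoints_finite hbdd t).toFinset with hM
    set w : Fin (N + 1) → Fin d → ℝ := fun j k => (n j k.succ : ℝ) with hw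
    set F := M.filter fun m => (fun k => (m k : ℝ)) ∈ returnCell (t • R) w j with hF
    have hMmem : ∀ m : Fin d → ℤ, m ∈ M ↔ (fun k => (m k : ℝ)) ∈ t • R := fun m => by
      rw [hM, Set.Finite.mem_toFinset]
      rfl
    have hFmem : ∀ m : Fin d → ℤ, m ∈ F ↔
        (fun k => (m k : ℝ)) ∈ returnCell (t • R) w j := fun m => by
      rw [hF, Finset.mem_filter, hMmem]
      exact and_iff_right_of_imp fun h => h.1
    obtain ⟨hc1, hc2⟩ := card_spacing_eq_bounds hind hbdd hu0 hmono hpos hsn (hlab t ht) j hFmem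
    have hc3 : (Finset.univ.filter fun i => (u : ℝ) * spacing ω hbdd t i =
        integerCombination ω (ν j)).card ≤ M.card - 1 := by
      rw [← card_fracPoints hind hbdd t]
      exact (Finset.card_le_univ _).trans (by rw [Fintype.card_fin])
    have hA := hfreq t w j M F _ ht hMmem hFmem hc1 hc2 hc3
    rw [← hG, ← card_fracPoints hind hbdd t] at hA
    set p : (Fin (d + 1) → UnitAddCircle) × (Fin (NumberField.Units.rank Φ) → unitInterval) :=
      (fun σ => ((U.frequency (ψ σ) * Real.log t : ℝ) : UnitAddCircle),
        fun b => fracUnit (U.exponent b * Real.log t)) with hp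
    -- The true displacements are the integer coordinates of u⁻¹ s_j, so the coordinate
    -- approximation applies to each of them; summing the constants makes it uniform.
    have hwV : ‖t⁻¹ • w - V p‖ ≤ (∑ j, ∑ k, C₂ j k) / t := by
      have h0 := hsum0 C₂ hC₂
      rw [pi_norm_le_iff_of_nonneg (by positivity)]
      intro j
      rw [pi_norm_le_iff_of_nonneg (by positivity)]
      intro k
      have := happrox j k t ht
      rw [← hu, hn, repr_sum_smul, Rat.cast_intCast] at this
      refine this.trans ?_
      gcongr
      exact hle C₂ hC₂ j k
    have hB : |(G (t⁻¹ • w) : Fin (N + 1) → ℝ) j - (G (V p) : Fin (N + 1) → ℝ) j| ≤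
        KG * ((∑ j, ∑ k, C₂ j k) / t) := by
      rw [← Real.dist_eq]
      refine (dist_le_pi_dist (G (t⁻¹ • w) : Fin (N + 1) → ℝ) (G (V p)) j).trans ?_
      refine (hGlip _ _).trans ?_
      gcongr
    calc _ ≤ _ := abs_sub_le _ ((G (t⁻¹ • w) : Fin (N + 1) → ℝ) j) _
      _ ≤ C₁ / t + KG * ((∑ j, ∑ k, C₂ j k) / t) := add_le_add hA hB
      _ = _ := by ring
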